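/- Let $d,m\in\mathbb{N}$, let $L_1,\dots,L_m\in\mathbb{C}^{d\times d}$, and put $\mathcal{D}(X)=\sum_{j=1}^m\big(L_jXL_j^\dagger-\tfrac12(L_j^\dagger L_jX+XL_j^\dagger L_j)\big)$. For a family $\mathcal{L}_t$ ($t\ge 0$) of linear maps on $\mathbb{C}^{d\times d}$, locally integrable in $t$, let $\mathcal{E}_{t,s}=\mathcal{T}\exp\big(\int_s^t\mathcal{L}_\tau\,d\tau\big)=\sum_{n\ge 0}\int_{s\le\tau_1\le\dots\le\tau_n\le t}\mathcal{L}_{\tau_n}\cdots\mathcal{L}_{\tau_1}\,d\tau_1\cdots d\tau_n$ $(t\ge s\ge 0)$ be the associated time-evolution map. Say that $\mathcal{L}_t$ is exponentially contractive with constant $K>0$ and rate $\gamma>0$ if $$\|\mathcal{E}_{t,s}(\rho-\sigma)\|_1\le K e^{-\gamma|t-s|}\,\|\rho-\sigma\|_1$$ for all density matrices $\rho,\sigma\in\mathbb{C}^{d\times d}$ (positive semidefinite, trace one) and all $t\ge s\ge 0$, and that $\mathcal{L}_t$ is exponentially contractive if such $K,\gamma>0$ exist. Here $\|\cdot\|_1$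 is the trace norm (sum of the singular values) and $\|\cdot\|_\infty$ is the operator norm (largest singular value). Theorem. Let $H(t)=H_0+V(t)$ for $t\ge 0$, where $H_0$ and all $V(t)$ are Hermitian $d\times d$ matrices and $V$ has locally integrable entries. Suppose that the constant Lindbladian $-i[H_0,\cdot\,]+\mathcal{D}$ is exponentially contractive with constant $K>0$ and rate $\gamma>0$. If $$\sup_{t\ge 0}\|V(t)\|_\infty<\frac{\gamma}{2+2\ln K},$$ then the driven Lindbladian $\mathcal{L}_t=-i[H(t),\cdot\,]+\mathcal{D}$ is also exponentially contractive. -/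

import Mathlib

/- On square complex matrices, `‖A‖` denotes the `ℓ²`-operator norm, i.e. the Schatten norm
`‖A‖_∞` (largest singular value). -/
open scoped Matrix ComplexOrder Matrix.Norms.L2Operator

namespace DrivenLindblad

/-- The trace norm (Schatten `1`-norm) `‖A‖₁`: the sum of the singular values of `A`, seen as an
operator on the Hilbert space `ℂ^d`. -/
noncomputable def traceNorm {d : ℕ} (A : Matrix (Fin d) (Fin d) ℂ) : ℝ :=
  ∑ i ∈ Finset.range d, (Matrix.toEuclideanLin A).singularValues i

/-- `ρ` is a quantum state (density matrix) on `ℂ^d`. -/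
def IsState {d : ℕ} (ρ : Matrix (Fin d) (Fin d) ℂ) : Prop :=
  ρ.PosSemidef ∧ ρ.trace = 1

/-- The Hamiltonian part `X ↦ -i [H, X]`. -/
noncomputable def hamiltonianPart {d : ℕ} (H : Matrix (Fin d) (Fin d) ℂ) :
    Matrix (Fin d) (Fin d) ℂ →ₗ[ℂ] Matrix (Fin d) (Fin d) ℂ where
  toFun X := (-Complex.I) • (H * X - X * H)
  map_add' X Y := by
    rw [mul_add, add_mul, ← smul_add]
    congr 1
    abel
  map_smul' c X := by
    rw [Matrix.mul_smul, Matrix.smul_mul, ← smul_sub, RingHom.id_apply, smul_comm]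

/-- The dissipator `X ↦ L X L† - {L† L, X} / 2` of a single jump operator `L`. -/
noncomputable def jumpDissipator {d : ℕ} (L : Matrix (Fin d) (Fin d) ℂ) :
    Matrix (Fin d) (Fin d) ℂ →ₗ[ℂ] Matrix (Fin d) (Fin d) ℂ where
  toFun X := L * X * Lᴴ - (1 / 2 : ℂ) • (Lᴴ * L * X + X * (Lᴴ * L))
  map_add' X Y := by
    simp only [mul_add, add_mul, smul_add]
    abel
  map_smul' c X := by
    simp only [Matrix.mul_smul, Matrix.smul_mul, RingHom.id_apply, smul_sub, smul_add,
      smul_comm c]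

/-- The Lindbladian `-i [H, ·] + ∑ⱼ 𝒟_{Lⱼ}` with Hamiltonian `H` and jump operators `L₁, …, L_m`. -/
noncomputable def lindbladian {d m : ℕ} (H : Matrix (Fin d) (Fin d) ℂ)
    (L : Fin m → Matrix (Fin d) (Fin d) ℂ) :
    Matrix (Fin d) (Fin d) ℂ →ₗ[ℂ] Matrix (Fin d) (Fin d) ℂ :=
  hamiltonianPart H + ∑ j, jumpDissipator (L j)

/-- The `n`-th term, applied to `X`, of the time-ordered exponential started at time `s`:
`∫_{s ≤ τ₁ ≤ … ≤ τ_n ≤ t} 𝓛_{τ_n} ⋯ 𝓛_{τ₁} X`, written as an iterated integral. -/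
noncomputable def dysonTerm {d : ℕ}
    (𝓛 : ℝ → Matrix (Fin d) (Fin d) ℂ →ₗ[ℂ] Matrix (Fin d) (Fin d) ℂ)
    (s : ℝ) (X : Matrix (Fin d) (Fin d) ℂ) : ℕ → ℝ → Matrix (Fin d) (Fin d) ℂ
  | 0, _ => X
  | n + 1, t => ∫ τ in s..t, 𝓛 τ (dysonTerm 𝓛 s X n τ)

/-- The time-evolution channel `ℰ_{t,s} = 𝒯 exp (∫_s^t 𝓛_τ dτ)` of a time-dependent generator,
given by the (Dyson) series of the time-ordered exponential. -/
noncomputable def timeEvolution {d : ℕ}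
    (𝓛 : ℝ → Matrix (Fin d) (Fin d) ℂ →ₗ[ℂ] Matrix (Fin d) (Fin d) ℂ)
    (t s : ℝ) (X : Matrix (Fin d) (Fin d) ℂ) : Matrix (Fin d) (Fin d) ℂ :=
  ∑' n, dysonTerm 𝓛 s X n t

/-- `𝓛` contracts exponentially with constant `K` and rate `γ`:
`‖ℰ_{t,s}(ρ - σ)‖₁ ≤ K e^{-γ|t-s|} ‖ρ - σ‖₁` for all states `ρ, σ` and all `t ≥ s ≥ 0`. -/
def ContractsWith {d : ℕ}
    (𝓛 : ℝ → Matrix (Fin d) (Fin d) ℂ →ₗ[ℂ] Matrix (Fin d) (Fin d) ℂ) (K γ : ℝ) : Prop :=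
  ∀ ρ σ : Matrix (Fin d) (Fin d) ℂ, IsState ρ → IsState σ → ∀ s t : ℝ, 0 ≤ s → s ≤ t →
    traceNorm (timeEvolution 𝓛 t s (ρ - σ)) ≤
      K * Real.exp (-γ * |t - s|) * traceNorm (ρ - σ)

/-- `𝓛` is exponentially contractive. -/
def IsExpContractive {d : ℕ}
    (𝓛 : ℝ → Matrix (Fin d) (Fin d) ℂ →ₗ[ℂ] Matrix (Fin d) (Fin d) ℂ) : Prop :=
  ∃ K γ : ℝ, 0 < K ∧ 0 < γ ∧ ContractsWith 𝓛 K γ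

end DrivenLindblad

/-! The driven evolution `Y` is compared with the undriven evolution `Z` started from the same
traceless Hermitian matrix at time `s`. Their difference `W = Y - Z` vanishes at time `s` and solves
the driven equation with source `-i[V, Z]`. Every Lindblad evolution is a trace-norm contraction, so
`‖W‖₁` grows at most by the integral of `‖-i[V, Z]‖₁ ≤ 2v‖Z‖₁`, where `v` bounds `‖V‖`. For `K ≥ 1`
there are two bounds on `‖Z‖₁ / ‖Y s‖₁` after elapsed time `τ`: `1`, and `K e^{-γτ}`. They cross at
`T₁ = ln K / γ`; using the first up to `T₁` and the second beyond gives `‖W‖₁ ≤ 2v(ln K + 1)/γ · ‖Y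
s‖₁`, and the threshold says exactly that this factor is below `1`. Adding `‖Z‖₁ ≤ K e^{-γT}‖Y s‖₁`
with `T` large makes the driven evolution a strict contraction over time `T`, uniformly in `s`
(`exists_uniform_contraction`). Trace and Hermiticity are preserved, so this iterates to exponential
decay.

The analytic core is `IsSolution.traceNorm_le_add_integral`, the growth bound with a source. It
comes directly from Euler steps: up to second order a step is a Kraus map
(`traceNorm_euler_step_le`), and second-order errors disappear under refinement. Since `V` is only
measurable in time, equations are used in integrated form and each step uses the integral of the
Hamiltonian. `IsBoundedHamiltonian.isSolution_timeEvolution` links these solutions to the Dyson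
series. -/

namespace DrivenLindblad

/-! ### Trace norm: duality with the operator norm, ideal bounds, Kraus maps. -/

section TraceNorm

open ContinuousLinearMap

variable {d : ℕ}

/-- A matrix maps a suitable orthonormal basis to an orthogonal family, the norms of which are its
singular values. -/
theorem exists_orthonormalBasis_inner_apply (A : Matrix (Fin d) (Fin d) ℂ) :
    ∃ (b : OrthonormalBasis (Fin d) ℂ (EuclideanSpace ℂ (Fin d))) (σ : Fin d → ℝ),
      traceNorm A = ∑ i, σ i ∧
      (∀ i, ‖Matrix.toEuclideanCLM (𝕜 := ℂ) A (b i)‖ = σ i) ∧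
      ∀ i j, inner ℂ (Matrix.toEuclideanCLM (𝕜 := ℂ) A (b i))
        (Matrix.toEuclideanCLM (𝕜 := ℂ) A (b j)) = if i = j then (σ i : ℂ) ^ 2 else 0 := by
  set T := Matrix.toEuclideanLin A with hT
  have hn : Module.finrank ℂ (EuclideanSpace ℂ (Fin d)) = d := by simp
  -- Right singular vectors: an eigenbasis of `T† T`.
  set b := T.isSymmetric_adjoint_comp_self.eigenvectorBasis hn with hb
  have hinner : ∀ i j, inner ℂ (T (b i)) (T (b j)) =
      if i = j then (T.singularValues i : ℂ) ^ 2 else 0 := by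
    intro i j
    have h1 : inner ℂ (T (b i)) (T (b j)) = inner ℂ (b i) ((LinearMap.adjoint T ∘ₗ T) (b j)) := by
      rw [LinearMap.comp_apply, LinearMap.adjoint_inner_right]
    rw [h1, hb, LinearMap.IsSymmetric.apply_eigenvectorBasis, inner_smul_right,
      OrthonormalBasis.inner_eq_ite, ← T.sq_singularValues_fin hn j]
    split_ifs with h
    · subst h; simp
    · simp
  refine ⟨b, fun i => T.singularValues i, ?_, ?_, hinner⟩
  · rw [traceNorm, Finset.sum_range]
  · intro i
    have h := hinner i i
    rw [if_pos rfl, inner_self_eq_norm_sq_to_K] at h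
    have h' : ‖T (b i)‖ ^ 2 = T.singularValues i ^ 2 := by
      apply Complex.ofReal_injective
      push_cast
      exact h
    exact (pow_left_inj₀ (norm_nonneg _) (T.singularValues_nonneg i) two_ne_zero).1 h'

theorem trace_eq_sum_inner_toEuclideanCLM (A : Matrix (Fin d) (Fin d) ℂ)
    (b : OrthonormalBasis (Fin d) ℂ (EuclideanSpace ℂ (Fin d))) :
    A.trace = ∑ i, inner ℂ (b i) (Matrix.toEuclideanCLM (𝕜 := ℂ) A (b i)) := by
  have h := LinearMap.trace_eq_sum_inner (Matrix.toEuclideanLin A) b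
  rw [Matrix.toEuclideanLin_eq_toLin_orthonormal, Matrix.trace_toLin_eq] at h
  rw [h, ← Matrix.toEuclideanLin_eq_toLin_orthonormal]
  rfl

theorem toEuclideanCLM_mul_apply (A B : Matrix (Fin d) (Fin d) ℂ) (x : EuclideanSpace ℂ (Fin d)) :
    Matrix.toEuclideanCLM (𝕜 := ℂ) (A * B) x =
      Matrix.toEuclideanCLM (𝕜 := ℂ) A (Matrix.toEuclideanCLM (𝕜 := ℂ) B x) := by
  rw [map_mul]
  rfl

theorem traceNorm_nonneg (A : Matrix (Fin d) (Fin d) ℂ) : 0 ≤ traceNorm A :=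
  Finset.sum_nonneg fun i _ => LinearMap.singularValues_nonneg _ i

/-- Hölder's inequality for the trace norm and the operator norm. -/
theorem norm_trace_mul_le (U A : Matrix (Fin d) (Fin d) ℂ) :
    ‖(U * A).trace‖ ≤ ‖U‖ * traceNorm A := by
  obtain ⟨b, σ, hσ, hnorm, -⟩ := exists_orthonormalBasis_inner_apply A
  rw [trace_eq_sum_inner_toEuclideanCLM _ b, hσ, Finset.mul_sum]
  refine norm_sum_le_of_le _ fun i _ => (norm_inner_le_norm _ _).trans ?_
  rw [b.norm_eq_one, one_mul, toEuclideanCLM_mul_apply, ← hnorm i, Matrix.cstar_norm_def]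
  exact le_opNorm _ _

/-- The trace norm is attained as a dual norm. -/
theorem exists_trace_mul_eq_traceNorm (A : Matrix (Fin d) (Fin d) ℂ) :
    ∃ U : Matrix (Fin d) (Fin d) ℂ, ‖U‖ ≤ 1 ∧ (U * A).trace = traceNorm A := by
  obtain ⟨b, σ, hσ, -, hinner⟩ := exists_orthonormalBasis_inner_apply A
  set T := Matrix.toEuclideanCLM (𝕜 := ℂ) A
  -- Adjoint of the polar factor: `T bᵢ / σᵢ ↦ bᵢ`. The convention `0⁻¹ = 0` drops the zero singular
  -- values.
  set S : EuclideanSpace ℂ (Fin d) →L[ℂ] EuclideanSpace ℂ (Fin d) :=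
    ∑ i, ((σ i : ℂ)⁻¹) • InnerProductSpace.rankOne ℂ (b i) (T (b i)) with hS
  have hSx : ∀ x, S x = ∑ i, ((σ i : ℂ)⁻¹ * inner ℂ (T (b i)) x) • b i := by
    intro x
    simp [hS, sum_apply, InnerProductSpace.rankOne_apply, smul_smul]
  refine ⟨(Matrix.toEuclideanCLM (𝕜 := ℂ)).symm S, ?_, ?_⟩
  · rw [Matrix.cstar_norm_def, StarAlgEquiv.apply_symm_apply]
    refine opNorm_le_bound _ zero_le_one fun x => ?_
    -- The normalised nonzero `T bᵢ` are orthonormal, so `‖S x‖ ≤ ‖x‖` is Bessel's inequality.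
    have hon : Orthonormal ℂ
        (fun i : {i : Fin d // σ i ≠ 0} => ((σ i : ℂ)⁻¹) • T (b i)) := by
      rw [orthonormal_iff_ite]
      rintro ⟨i, hi⟩ ⟨j, hj⟩
      simp only [inner_smul_left, inner_smul_right, hinner, Subtype.mk.injEq]
      have hi' : (σ i : ℂ) ≠ 0 := by exact_mod_cast hi
      split_ifs with h
      · subst h
        simp only [map_inv₀, Complex.conj_ofReal]
        field_simp
      · simp
    have hbessel := hon.sum_inner_products_le x (s := Finset.univ)
    rw [one_mul]
    refine le_of_sq_le_sq ?_ (norm_nonneg _)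
    rw [← b.sum_sq_norm_inner_right]
    refine le_trans (le_of_eq ?_) hbessel
    rw [← Finset.sum_subtype (Finset.univ.filter fun i => σ i ≠ 0) (by simp)
      (fun i => ‖inner ℂ (((σ i : ℂ)⁻¹) • T (b i)) x‖ ^ 2), Finset.sum_filter]
    refine Finset.sum_congr rfl fun i _ => ?_
    rw [hSx, inner_sum, Finset.sum_eq_single i
      (fun j _ hj => by rw [inner_smul_right, b.inner_eq_ite, if_neg hj.symm, mul_zero])
      (by simp), inner_smul_right, b.inner_eq_ite, if_pos rfl, mul_one, inner_smul_left]
    split_ifs with h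
    · simp
    · simp [not_not.1 h]
  · rw [trace_eq_sum_inner_toEuclideanCLM _ b, hσ, Complex.ofReal_sum]
    refine Finset.sum_congr rfl fun j _ => ?_
    rw [toEuclideanCLM_mul_apply, StarAlgEquiv.apply_symm_apply, hSx, inner_sum]
    simp only [inner_smul_right, b.inner_eq_ite, hinner, T]
    rw [Finset.sum_eq_single j]
    · simp only [if_true, mul_one]
      by_cases h : (σ j : ℂ) = 0
      · simp [h]
      · field_simp
    · intro i _ hij
      simp [hij]
    · simp

/-- The duality supremum is attained, so testing against contractions suffices. The triangle
inequality and the ideal bounds follow without further use of singular values. -/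
theorem traceNorm_le_of_forall {A : Matrix (Fin d) (Fin d) ℂ} {c : ℝ}
    (h : ∀ U : Matrix (Fin d) (Fin d) ℂ, ‖U‖ ≤ 1 → ‖(U * A).trace‖ ≤ c) : traceNorm A ≤ c := by
  obtain ⟨U, hU, hA⟩ := exists_trace_mul_eq_traceNorm A
  simpa [hA, abs_of_nonneg (traceNorm_nonneg A)] using h U hU

theorem norm_trace_mul_le_of_norm_le_one {U : Matrix (Fin d) (Fin d) ℂ} (hU : ‖U‖ ≤ 1)
    (A : Matrix (Fin d) (Fin d) ℂ) : ‖(U * A).trace‖ ≤ traceNorm A :=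
  (norm_trace_mul_le U A).trans (mul_le_of_le_one_left (traceNorm_nonneg A) hU)

theorem traceNorm_add_le (A B : Matrix (Fin d) (Fin d) ℂ) :
    traceNorm (A + B) ≤ traceNorm A + traceNorm B := by
  refine traceNorm_le_of_forall fun U hU => ?_
  rw [mul_add, Matrix.trace_add]
  exact (norm_add_le _ _).trans (add_le_add (norm_trace_mul_le_of_norm_le_one hU A)
    (norm_trace_mul_le_of_norm_le_one hU B))

theorem traceNorm_smul_le (c : ℂ) (A : Matrix (Fin d) (Fin d) ℂ) :
    traceNorm (c • A) ≤ ‖c‖ * traceNorm A := by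
  refine traceNorm_le_of_forall fun U hU => ?_
  rw [Matrix.mul_smul, Matrix.trace_smul, norm_smul]
  exact mul_le_mul_of_nonneg_left (norm_trace_mul_le_of_norm_le_one hU A) (norm_nonneg c)

theorem traceNorm_smul (c : ℂ) (A : Matrix (Fin d) (Fin d) ℂ) :
    traceNorm (c • A) = ‖c‖ * traceNorm A := by
  refine (traceNorm_smul_le c A).antisymm ?_
  rcases eq_or_ne c 0 with rfl | hc
  · simpa using traceNorm_nonneg _
  · have h := traceNorm_smul_le c⁻¹ (c • A)
    rw [inv_smul_smul₀ hc, norm_inv] at h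
    rwa [← le_inv_mul_iff₀ (by positivity)]

theorem traceNorm_zero : traceNorm (0 : Matrix (Fin d) (Fin d) ℂ) = 0 := by
  simpa using traceNorm_smul 0 (0 : Matrix (Fin d) (Fin d) ℂ)

theorem traceNorm_neg (A : Matrix (Fin d) (Fin d) ℂ) : traceNorm (-A) = traceNorm A := by
  simpa using traceNorm_smul (-1) A

theorem traceNorm_sub_le (A B : Matrix (Fin d) (Fin d) ℂ) :
    traceNorm (A - B) ≤ traceNorm A + traceNorm B := by
  simpa [sub_eq_add_neg, traceNorm_neg] using traceNorm_add_le A (-B)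

theorem norm_trace_le_card_mul_norm (A : Matrix (Fin d) (Fin d) ℂ) : ‖A.trace‖ ≤ d * ‖A‖ := by
  rw [trace_eq_sum_inner_toEuclideanCLM A (EuclideanSpace.basisFun (Fin d) ℂ)]
  have h : ∀ i ∈ (Finset.univ : Finset (Fin d)),
      ‖inner ℂ (EuclideanSpace.basisFun (Fin d) ℂ i)
        (Matrix.toEuclideanCLM (𝕜 := ℂ) A (EuclideanSpace.basisFun (Fin d) ℂ i))‖ ≤ ‖A‖ := by
    intro i _
    refine (norm_inner_le_norm _ _).trans ?_
    rw [OrthonormalBasis.norm_eq_one, one_mul, Matrix.cstar_norm_def]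
    refine (le_opNorm _ _).trans ?_
    rw [OrthonormalBasis.norm_eq_one, mul_one]
  simpa using norm_sum_le_of_le _ h

/-- A crude comparison that lets operator-norm estimates of solutions enter second-order errors,
where the factor `d` is harmless. -/
theorem traceNorm_le_card_mul_norm (A : Matrix (Fin d) (Fin d) ℂ) : traceNorm A ≤ d * ‖A‖ := by
  refine traceNorm_le_of_forall fun U hU => (norm_trace_le_card_mul_norm _).trans ?_
  refine mul_le_mul_of_nonneg_left ((norm_mul_le _ _).trans ?_) d.cast_nonneg
  exact mul_le_of_le_one_left (norm_nonneg A) hU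

theorem eq_zero_of_traceNorm_eq_zero {A : Matrix (Fin d) (Fin d) ℂ} (h : traceNorm A = 0) :
    A = 0 := by
  have h' := norm_trace_mul_le Aᴴ A
  rw [h, mul_zero, norm_le_zero_iff] at h'
  exact Matrix.trace_conjTranspose_mul_self_eq_zero_iff.1 h'

theorem traceNorm_mul_le_left (A B : Matrix (Fin d) (Fin d) ℂ) :
    traceNorm (A * B) ≤ ‖A‖ * traceNorm B := by
  refine traceNorm_le_of_forall fun U hU => ?_
  rw [← mul_assoc]
  refine (norm_trace_mul_le _ _).trans (mul_le_mul_of_nonneg_right ?_ (traceNorm_nonneg B))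
  exact (norm_mul_le _ _).trans (mul_le_of_le_one_left (norm_nonneg A) hU)

theorem traceNorm_mul_le_right (A B : Matrix (Fin d) (Fin d) ℂ) :
    traceNorm (A * B) ≤ traceNorm A * ‖B‖ := by
  refine traceNorm_le_of_forall fun U hU => ?_
  rw [← mul_assoc, Matrix.trace_mul_comm, ← mul_assoc, mul_comm]
  refine (norm_trace_mul_le _ _).trans (mul_le_mul_of_nonneg_right ?_ (traceNorm_nonneg A))
  exact (norm_mul_le _ _).trans (mul_le_of_le_one_right (norm_nonneg B) hU)

/-- Expand `⟨x, ∑ Kⱼ† U Kⱼ y⟩ = ∑ ⟨Kⱼ x, U Kⱼ y⟩`, apply Cauchy–Schwarz over `j`, and use `∑ ‖Kⱼ x‖²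
= ⟨x, ∑ Kⱼ† Kⱼ x⟩`. This bounds the dual of a Kraus map. -/
theorem norm_sum_conjTranspose_mul_mul_le {ι : Type*} [Fintype ι]
    (K : ι → Matrix (Fin d) (Fin d) ℂ) (U : Matrix (Fin d) (Fin d) ℂ) :
    ‖∑ j, (K j)ᴴ * U * K j‖ ≤ ‖U‖ * ‖∑ j, (K j)ᴴ * K j‖ := by
  set e := Matrix.toEuclideanCLM (n := Fin d) (𝕜 := ℂ) with he
  set M := ‖∑ j, (K j)ᴴ * K j‖ with hM
  have hadj : ∀ (A : Matrix (Fin d) (Fin d) ℂ) x y, inner ℂ x (e Aᴴ y) = inner ℂ (e A x) y := by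
    intro A x y
    rw [← Matrix.star_eq_conjTranspose, map_star, star_eq_adjoint, adjoint_inner_right]
  have hle : ∀ (A : Matrix (Fin d) (Fin d) ℂ) x, ‖e A x‖ ≤ ‖A‖ * ‖x‖ := by
    intro A x
    rw [Matrix.cstar_norm_def]
    exact le_opNorm _ _
  have hsq : ∀ x, ∑ j, ‖e (K j) x‖ ^ 2 ≤ M * ‖x‖ ^ 2 := by
    intro x
    have h1 : ((∑ j, ‖e (K j) x‖ ^ 2 : ℝ) : ℂ) = inner ℂ x (e (∑ j, (K j)ᴴ * K j) x) := by
      rw [map_sum, sum_apply, inner_sum]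
      push_cast
      refine Finset.sum_congr rfl fun j _ => ?_
      rw [toEuclideanCLM_mul_apply, hadj, inner_self_eq_norm_sq_to_K]
      rfl
    have h2 : ‖((∑ j, ‖e (K j) x‖ ^ 2 : ℝ) : ℂ)‖ ≤ ‖x‖ * (M * ‖x‖) := by
      rw [h1]
      exact (norm_inner_le_norm _ _).trans
        (mul_le_mul_of_nonneg_left (hle _ _) (norm_nonneg x))
    rw [Complex.norm_real] at h2
    calc _ ≤ _ := (le_abs_self _).trans h2
      _ = _ := by ring
  rw [Matrix.cstar_norm_def]
  refine opNorm_le_bound _ (by positivity) fun y => ?_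
  set S := e (∑ j, (K j)ᴴ * U * K j) with hS
  have hbil : ∀ x, ‖inner ℂ x (S y)‖ ≤ ‖U‖ * (M * (‖x‖ * ‖y‖)) := by
    intro x
    have h1 : inner ℂ x (S y) = ∑ j, inner ℂ (e (K j) x) (e U (e (K j) y)) := by
      rw [hS, map_sum, sum_apply, inner_sum]
      refine Finset.sum_congr rfl fun j _ => ?_
      rw [toEuclideanCLM_mul_apply, toEuclideanCLM_mul_apply, hadj]
    rw [h1]
    calc _ ≤ ∑ j, ‖U‖ * (‖e (K j) x‖ * ‖e (K j) y‖) := by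
          refine norm_sum_le_of_le _ fun j _ => (norm_inner_le_norm _ _).trans ?_
          calc _ ≤ ‖e (K j) x‖ * (‖U‖ * ‖e (K j) y‖) :=
                mul_le_mul_of_nonneg_left (hle _ _) (norm_nonneg _)
            _ = _ := by ring
      _ = ‖U‖ * ∑ j, ‖e (K j) x‖ * ‖e (K j) y‖ := by rw [Finset.mul_sum]
      _ ≤ ‖U‖ * (M * (‖x‖ * ‖y‖)) := by
          refine mul_le_mul_of_nonneg_left ?_ (norm_nonneg U)
          refine le_of_sq_le_sq ?_ (by positivity)
          calc _ ≤ _ := Finset.sum_mul_sq_le_sq_mul_sq _ _ _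
            _ ≤ (M * ‖x‖ ^ 2) * (M * ‖y‖ ^ 2) :=
                mul_le_mul (hsq x) (hsq y) (Finset.sum_nonneg fun _ _ => sq_nonneg _)
                  (by positivity)
            _ = _ := by ring
  have h := hbil (S y)
  rw [inner_self_eq_norm_sq_to_K] at h
  simp only [norm_pow, RCLike.norm_ofReal, abs_norm] at h
  rcases (norm_nonneg (S y)).eq_or_lt with h0 | h0
  · rw [← h0]; positivity
  · refine le_of_mul_le_mul_left ?_ h0
    calc _ = ‖S y‖ ^ 2 := by ring
      _ ≤ _ := h
      _ = _ := by ring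

/-- A completely positive map in Kraus form `X ↦ ∑ⱼ Kⱼ X Kⱼ†` is bounded in trace norm by
`‖∑ⱼ Kⱼ† Kⱼ‖`. -/
theorem traceNorm_sum_mul_mul_conjTranspose_le {ι : Type*} [Fintype ι]
    (K : ι → Matrix (Fin d) (Fin d) ℂ) (X : Matrix (Fin d) (Fin d) ℂ) :
    traceNorm (∑ j, K j * X * (K j)ᴴ) ≤ ‖∑ j, (K j)ᴴ * K j‖ * traceNorm X := by
  refine traceNorm_le_of_forall fun U hU => ?_
  have h : (U * ∑ j, K j * X * (K j)ᴴ).trace = ((∑ j, (K j)ᴴ * U * K j) * X).trace := by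
    rw [Finset.mul_sum, Finset.sum_mul, Matrix.trace_sum, Matrix.trace_sum]
    refine Finset.sum_congr rfl fun j _ => ?_
    rw [← mul_assoc, Matrix.trace_mul_comm]
    simp only [mul_assoc]
  rw [h]
  refine (norm_trace_mul_le _ _).trans (mul_le_mul_of_nonneg_right ?_ (traceNorm_nonneg X))
  exact (norm_sum_conjTranspose_mul_mul_le K U).trans
    (mul_le_of_le_one_left (norm_nonneg _) hU)

end TraceNorm

/-! ### Norm bounds on the Lindbladian and the Euler step. -/

section Dissipativity

open MeasureTheory Set Filter Topology

variable {d m : ℕ}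

/-- Only an inequality, because the norm is `0` when `d = 0`. -/
theorem norm_one_matrix_le : ‖(1 : Matrix (Fin d) (Fin d) ℂ)‖ ≤ 1 := by
  rw [Matrix.cstar_norm_def, map_one]
  exact ContinuousLinearMap.norm_id_le

/-- A real function the increments of which are bounded above by a multiple of the squared
step does not increase. -/
theorem le_of_forall_le_add_mul_sq {f : ℝ → ℝ} {a b C : ℝ} (hab : a ≤ b)
    (h : ∀ x y, a ≤ x → x ≤ y → y ≤ b → f y ≤ f x + C * (y - x) ^ 2) : f b ≤ f a := by
  -- With `n + 1` equal steps the accumulated error is `C (b - a)² / (n + 1)`, which tends to `0`.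
  have key : ∀ n : ℕ, f b ≤ f a + C * (b - a) ^ 2 * (1 / ((n : ℝ) + 1)) := by
    intro n
    set δ : ℝ := (b - a) / ((n : ℝ) + 1) with hδ
    have hn : (0 : ℝ) < (n : ℝ) + 1 := by positivity
    have hδ0 : 0 ≤ δ := div_nonneg (sub_nonneg.2 hab) hn.le
    have hδn : ((n : ℝ) + 1) * δ = b - a := by rw [hδ]; field_simp
    have step : ∀ k : ℕ, k ≤ n + 1 → f (a + k * δ) ≤ f a + k * (C * δ ^ 2) := by
      intro k
      induction k with
      | zero => simp
      | succ k ih =>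
        intro hk
        have hk' : ((k : ℝ) + 1) ≤ (n : ℝ) + 1 := by exact_mod_cast hk
        have h1 := h (a + k * δ) (a + ((k : ℝ) + 1) * δ) (by nlinarith [k.cast_nonneg (α := ℝ)])
          (by nlinarith) (by nlinarith)
        have h2 := ih (by omega)
        push_cast
        have h3 : a + ((k : ℝ) + 1) * δ - (a + k * δ) = δ := by ring
        rw [h3] at h1
        linarith
    have h1 := step (n + 1) le_rfl
    push_cast at h1
    rw [hδn] at h1
    have h2 : a + (b - a) = b := by ring
    have h3 : ((n : ℝ) + 1) * (C * δ ^ 2) = C * (b - a) ^ 2 * (1 / ((n : ℝ) + 1)) := by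
      rw [hδ]; field_simp
    rwa [h2, h3] at h1
  have hlim : Tendsto (fun n : ℕ => f a + C * (b - a) ^ 2 * (1 / ((n : ℝ) + 1))) atTop
      (𝓝 (f a + C * (b - a) ^ 2 * 0)) :=
    (tendsto_one_div_add_atTop_nhds_zero_nat.const_mul _).const_add _
  rw [mul_zero, add_zero] at hlim
  exact ge_of_tendsto' hlim key

theorem hamiltonianPart_apply (H X : Matrix (Fin d) (Fin d) ℂ) :
    hamiltonianPart H X = (-Complex.I) • (H * X - X * H) := rfl

theorem jumpDissipator_apply (L X : Matrix (Fin d) (Fin d) ℂ) :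
    jumpDissipator L X = L * X * Lᴴ - (1 / 2 : ℂ) • (Lᴴ * L * X + X * (Lᴴ * L)) := rfl

theorem lindbladian_apply (H : Matrix (Fin d) (Fin d) ℂ) (L : Fin m → Matrix (Fin d) (Fin d) ℂ)
    (X : Matrix (Fin d) (Fin d) ℂ) :
    lindbladian H L X = hamiltonianPart H X + ∑ j, jumpDissipator (L j) X := by
  simp [lindbladian]

theorem lindbladian_add_apply (H V : Matrix (Fin d) (Fin d) ℂ)
    (L : Fin m → Matrix (Fin d) (Fin d) ℂ) (X : Matrix (Fin d) (Fin d) ℂ) :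
    lindbladian (H + V) L X = lindbladian H L X + hamiltonianPart V X := by
  simp only [lindbladian_apply, hamiltonianPart_apply, add_mul, mul_add, ← smul_add,
    add_right_comm _ _ ((-Complex.I) • (V * X - X * V))]
  congr 2
  abel

theorem norm_hamiltonianPart_le (H X : Matrix (Fin d) (Fin d) ℂ) :
    ‖hamiltonianPart H X‖ ≤ 2 * ‖H‖ * ‖X‖ := by
  rw [hamiltonianPart_apply, norm_smul, norm_neg, Complex.norm_I, one_mul]
  have h1 := norm_mul_le H X
  have h2 := norm_mul_le X H
  have h3 := norm_sub_le (H * X) (X * H)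
  linarith

theorem traceNorm_hamiltonianPart_le (H X : Matrix (Fin d) (Fin d) ℂ) :
    traceNorm (hamiltonianPart H X) ≤ 2 * ‖H‖ * traceNorm X := by
  rw [hamiltonianPart_apply, traceNorm_smul, norm_neg, Complex.norm_I, one_mul]
  have h1 := traceNorm_mul_le_left H X
  have h2 := traceNorm_mul_le_right X H
  have h3 := traceNorm_sub_le (H * X) (X * H)
  linarith

theorem norm_jumpDissipator_le (L X : Matrix (Fin d) (Fin d) ℂ) :
    ‖jumpDissipator L X‖ ≤ 2 * ‖L‖ ^ 2 * ‖X‖ := by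
  rw [jumpDissipator_apply]
  have hL : ‖Lᴴ‖ = ‖L‖ := Matrix.l2_opNorm_conjTranspose L
  have h1 : ‖L * X * Lᴴ‖ ≤ ‖L‖ * ‖X‖ * ‖L‖ := by
    refine (norm_mul_le _ _).trans ?_
    rw [hL]
    gcongr
    exact norm_mul_le _ _
  have h0 : ‖Lᴴ * L‖ ≤ ‖L‖ * ‖L‖ := (Matrix.l2_opNorm_conjTranspose_mul_self L).le
  have h2 : ‖Lᴴ * L * X‖ ≤ ‖L‖ * ‖L‖ * ‖X‖ := (norm_mul_le _ _).trans (by gcongr)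
  have h3 : ‖X * (Lᴴ * L)‖ ≤ ‖X‖ * (‖L‖ * ‖L‖) := (norm_mul_le _ _).trans (by gcongr)
  have h4 := norm_sub_le (L * X * Lᴴ) ((1 / 2 : ℂ) • (Lᴴ * L * X + X * (Lᴴ * L)))
  have h5 := norm_add_le (Lᴴ * L * X) (X * (Lᴴ * L))
  have h6 : ‖(1 / 2 : ℂ)‖ = 1 / 2 := by norm_num
  rw [norm_smul, h6] at h4
  nlinarith

theorem norm_lindbladian_le (H : Matrix (Fin d) (Fin d) ℂ)
    (L : Fin m → Matrix (Fin d) (Fin d) ℂ) (X : Matrix (Fin d) (Fin d) ℂ) :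
    ‖lindbladian H L X‖ ≤ (2 * ‖H‖ + ∑ j, 2 * ‖L j‖ ^ 2) * ‖X‖ := by
  rw [lindbladian_apply, add_mul, Finset.sum_mul]
  exact (norm_add_le _ _).trans (add_le_add (norm_hamiltonianPart_le H X)
    (norm_sum_le_of_le _ fun j _ => norm_jumpDissipator_le (L j) X))

/-- One Euler step of a Lindblad equation does not increase the trace norm, up to an error that
is quadratic in the length of the step. -/
theorem traceNorm_euler_step_le {H : Matrix (Fin d) (Fin d) ℂ} (hH : H.IsHermitian)
    (L : Fin m → Matrix (Fin d) (Fin d) ℂ) {h : ℝ} (hh : 0 ≤ h) (X : Matrix (Fin d) (Fin d) ℂ) :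
    traceNorm (X + hamiltonianPart H X + (h : ℂ) • ∑ j, jumpDissipator (L j) X) ≤
      (1 + 2 * (‖H‖ + h * ‖∑ j, (L j)ᴴ * L j‖) ^ 2) * traceNorm X := by
  set P := ∑ j, (L j)ᴴ * L j with hP
  -- Kraus operators `1 + B` and `√h Lⱼ` reproduce the Euler step up to `B X B†`. Since `B + B† =
  -- -hP`, the first-order terms of `∑ K† K` cancel, leaving `1 + B† B`. Here `H` is not scaled by
  -- `h`: it stands for a Hamiltonian already integrated over the step.
  set B : Matrix (Fin d) (Fin d) ℂ := (-Complex.I) • H - ((h / 2 : ℝ) : ℂ) • P with hB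
  set K : Option (Fin m) → Matrix (Fin d) (Fin d) ℂ :=
    fun o => o.elim (1 + B) fun j => ((√h : ℝ) : ℂ) • L j with hK
  have hPh : Pᴴ = P := by
    simp [hP, Matrix.conjTranspose_sum, Matrix.conjTranspose_mul]
  have hBh : Bᴴ = Complex.I • H - ((h / 2 : ℝ) : ℂ) • P := by
    rw [hB, Matrix.conjTranspose_sub, Matrix.conjTranspose_smul, Matrix.conjTranspose_smul, hPh,
      hH.eq]
    simp
  have hsqrt : ((√h : ℝ) : ℂ) * ((√h : ℝ) : ℂ) = h := by
    rw [← Complex.ofReal_mul, Real.mul_self_sqrt hh]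
  have hKK : ∑ o, (K o)ᴴ * K o = 1 + Bᴴ * B := by
    have h1 : ∑ j, (((√h : ℝ) : ℂ) • L j)ᴴ * (((√h : ℝ) : ℂ) • L j) = (h : ℂ) • P := by
      rw [hP, Finset.smul_sum]
      refine Finset.sum_congr rfl fun j _ => ?_
      rw [Matrix.conjTranspose_smul, Matrix.smul_mul, Matrix.mul_smul, smul_smul,
        Complex.star_def, Complex.conj_ofReal, hsqrt]
    have h2 : B + Bᴴ = -((h : ℂ) • P) := by
      rw [hBh, hB]
      push_cast
      module
    rw [Fintype.sum_option]
    simp only [hK, Option.elim]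
    rw [h1, Matrix.conjTranspose_add, Matrix.conjTranspose_one]
    calc (1 + Bᴴ) * (1 + B) + (h : ℂ) • P = 1 + (B + Bᴴ) + Bᴴ * B + (h : ℂ) • P := by noncomm_ring
      _ = _ := by rw [h2]; abel
  have hKX : X + hamiltonianPart H X + (h : ℂ) • ∑ j, jumpDissipator (L j) X =
      ∑ o, K o * X * (K o)ᴴ - B * X * Bᴴ := by
    have h1 : ∑ j, (((√h : ℝ) : ℂ) • L j) * X * (((√h : ℝ) : ℂ) • L j)ᴴ =
        (h : ℂ) • ∑ j, L j * X * (L j)ᴴ := by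
      rw [Finset.smul_sum]
      refine Finset.sum_congr rfl fun j _ => ?_
      rw [Matrix.conjTranspose_smul, Matrix.smul_mul, Matrix.smul_mul, Matrix.mul_smul, smul_smul,
        Complex.star_def, Complex.conj_ofReal, hsqrt]
    have h2 : ∑ j, jumpDissipator (L j) X =
        ∑ j, L j * X * (L j)ᴴ - (1 / 2 : ℂ) • (P * X + X * P) := by
      simp only [jumpDissipator_apply]
      rw [Finset.sum_sub_distrib, ← Finset.smul_sum, Finset.sum_add_distrib, hP, Finset.sum_mul,
        Finset.mul_sum]
    rw [Fintype.sum_option]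
    simp only [hK, Option.elim]
    rw [h1, h2, Matrix.conjTranspose_add, Matrix.conjTranspose_one, hamiltonianPart_apply]
    have h3 : (1 + B) * X * (1 + Bᴴ) = X + B * X + X * Bᴴ + B * X * Bᴴ := by noncomm_ring
    have h4 : B * X + X * Bᴴ = (-Complex.I) • (H * X - X * H) -
        ((h / 2 : ℝ) : ℂ) • (P * X + X * P) := by
      rw [hBh, hB, sub_mul, mul_sub, Matrix.smul_mul, Matrix.smul_mul, Matrix.mul_smul,
        Matrix.mul_smul]
      module
    rw [h3, add_assoc X (B * X), h4]
    push_cast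
    module
  have hBn : ‖B‖ ≤ ‖H‖ + h * ‖P‖ := by
    refine (norm_sub_le _ _).trans ?_
    rw [norm_smul, norm_smul, norm_neg, Complex.norm_I, one_mul, Complex.norm_real,
      Real.norm_of_nonneg (by positivity)]
    have : 0 ≤ h * ‖P‖ := by positivity
    linarith
  have hBh_norm : ‖Bᴴ‖ = ‖B‖ := Matrix.l2_opNorm_conjTranspose B
  have hKK_norm : ‖∑ o, (K o)ᴴ * K o‖ ≤ 1 + ‖B‖ ^ 2 := by
    rw [hKK]
    refine (norm_add_le _ _).trans (add_le_add norm_one_matrix_le ?_)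
    rw [Matrix.l2_opNorm_conjTranspose_mul_self, sq]
  have hBXB : traceNorm (B * X * Bᴴ) ≤ ‖B‖ ^ 2 * traceNorm X := by
    refine (traceNorm_mul_le_right _ _).trans ?_
    rw [hBh_norm]
    calc _ ≤ ‖B‖ * traceNorm X * ‖B‖ :=
          mul_le_mul_of_nonneg_right (traceNorm_mul_le_left _ _) (norm_nonneg _)
      _ = _ := by ring
  have hX := traceNorm_nonneg X
  calc _ ≤ traceNorm (∑ o, K o * X * (K o)ᴴ) + traceNorm (B * X * Bᴴ) := by
        rw [hKX]; exact traceNorm_sub_le _ _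
    _ ≤ (1 + ‖B‖ ^ 2) * traceNorm X + ‖B‖ ^ 2 * traceNorm X :=
        add_le_add ((traceNorm_sum_mul_mul_conjTranspose_le K X).trans
          (mul_le_mul_of_nonneg_right hKK_norm hX)) hBXB
    _ = (1 + 2 * ‖B‖ ^ 2) * traceNorm X := by ring
    _ ≤ _ := by gcongr

/-- Pairing with a fixed contraction `U` is a continuous linear functional, so it passes through the
integral. -/
theorem traceNorm_integral_le {f : ℝ → Matrix (Fin d) (Fin d) ℂ} {φ : ℝ → ℝ} {a b : ℝ}
    (hab : a ≤ b) (hf : IntervalIntegrable f volume a b) (hφ : IntervalIntegrable φ volume a b)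
    (h : ∀ τ ∈ Ioc a b, traceNorm (f τ) ≤ φ τ) :
    traceNorm (∫ τ in a..b, f τ) ≤ ∫ τ in a..b, φ τ := by
  refine traceNorm_le_of_forall fun U hU => ?_
  set T : Matrix (Fin d) (Fin d) ℂ →L[ℂ] ℂ := LinearMap.toContinuousLinearMap
    ((Matrix.traceLinearMap (Fin d) ℂ ℂ).comp (LinearMap.mulLeft ℂ U)) with hT
  have hTX : ∀ X, T X = (U * X).trace := fun X => rfl
  rw [← hTX, ← T.intervalIntegral_comp_comm hf]
  refine intervalIntegral.norm_integral_le_of_norm_le hab (ae_of_all _ fun τ hτ => ?_) hφ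
  rw [hTX]
  exact (norm_trace_mul_le_of_norm_le_one hU _).trans (h τ hτ)

theorem conjTranspose_integral {f : ℝ → Matrix (Fin d) (Fin d) ℂ} {a b : ℝ}
    (hf : IntervalIntegrable f volume a b) :
    (∫ τ in a..b, f τ)ᴴ = ∫ τ in a..b, (f τ)ᴴ := by
  have h := (starL' ℝ (A := Matrix (Fin d) (Fin d) ℂ)).toContinuousLinearMap.intervalIntegral_comp_comm
    hf
  exact h.symm

theorem trace_integral {f : ℝ → Matrix (Fin d) (Fin d) ℂ} {a b : ℝ}
    (hf : IntervalIntegrable f volume a b) :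
    (∫ τ in a..b, f τ).trace = ∫ τ in a..b, (f τ).trace :=
  ((LinearMap.toContinuousLinearMap
    (Matrix.traceLinearMap (Fin d) ℂ ℂ)).intervalIntegral_comp_comm hf).symm

theorem hamiltonianPart_integral {H : ℝ → Matrix (Fin d) (Fin d) ℂ} {a b : ℝ}
    (hH : IntervalIntegrable H volume a b) (X : Matrix (Fin d) (Fin d) ℂ) :
    hamiltonianPart (∫ τ in a..b, H τ) X = ∫ τ in a..b, hamiltonianPart (H τ) X :=
  ((LinearMap.toContinuousLinearMap ((-Complex.I) •
    (LinearMap.mulRight ℂ X - LinearMap.mulLeft ℂ X))).intervalIntegral_comp_comm hH).symm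

end Dissipativity

/-! ### Integrated Lindblad equations and growth of the trace norm. -/

section Solutions

open MeasureTheory Set Filter Topology

variable {d m : ℕ}

/-- A measurable family of Hamiltonians that is Hermitian and bounded by `c` at nonnegative
times. -/
structure IsBoundedHamiltonian (H : ℝ → Matrix (Fin d) (Fin d) ℂ) (c : ℝ) : Prop where
  isHermitian : ∀ t, 0 ≤ t → (H t).IsHermitian
  norm_le : ∀ t, 0 ≤ t → ‖H t‖ ≤ c
  aestronglyMeasurable : AEStronglyMeasurable H (volume.restrict (Ici 0))

/-- `W` solves `W' = 𝓛_t W + g` on `[s, ∞)` in integrated form. -/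
structure IsSolution (H : ℝ → Matrix (Fin d) (Fin d) ℂ) (L : Fin m → Matrix (Fin d) (Fin d) ℂ)
    (g : ℝ → Matrix (Fin d) (Fin d) ℂ) (s : ℝ) (W : ℝ → Matrix (Fin d) (Fin d) ℂ) : Prop where
  continuousOn : ContinuousOn W (Ici s)
  eq_add_integral : ∀ t, s ≤ t → W t = W s + ∫ τ in s..t, (lindbladian (H τ) L (W τ) + g τ)

theorem uIoc_subset_Ici {s a b : ℝ} (ha : s ≤ a) (hab : a ≤ b) : uIoc a b ⊆ Ici s := by
  rw [uIoc_of_le hab]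
  exact fun x hx => ha.trans hx.1.le

theorem intervalIntegrable_of_norm_le {E : Type*} [NormedAddCommGroup E] {f : ℝ → E}
    {s a b C : ℝ} (hf : AEStronglyMeasurable f (volume.restrict (Ici s))) (ha : s ≤ a)
    (hab : a ≤ b) (hC : ∀ τ ∈ Icc a b, ‖f τ‖ ≤ C) : IntervalIntegrable f volume a b := by
  refine (intervalIntegrable_const (c := C)).mono_fun
    (hf.mono_measure (Measure.restrict_mono (uIoc_subset_Ici ha hab) le_rfl)) ?_
  rw [uIoc_of_le hab]
  refine (ae_restrict_iff' measurableSet_Ioc).2 (ae_of_all _ fun τ hτ => ?_)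
  exact (hC τ (Ioc_subset_Icc_self hτ)).trans (le_abs_self C)

namespace IsBoundedHamiltonian

variable {H : ℝ → Matrix (Fin d) (Fin d) ℂ} {c : ℝ}

theorem nonneg (hH : IsBoundedHamiltonian H c) : 0 ≤ c := (norm_nonneg _).trans (hH.norm_le 0 le_rfl)

theorem intervalIntegrable (hH : IsBoundedHamiltonian H c) {a b : ℝ} (ha : 0 ≤ a) (hab : a ≤ b) :
    IntervalIntegrable H volume a b :=
  intervalIntegrable_of_norm_le hH.aestronglyMeasurable ha hab
    fun τ hτ => hH.norm_le τ (ha.trans hτ.1)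

theorem aestronglyMeasurable_hamiltonianPart (hH : IsBoundedHamiltonian H c) {s : ℝ} (hs : 0 ≤ s)
    {W : ℝ → Matrix (Fin d) (Fin d) ℂ} (hW : ContinuousOn W (Ici s)) :
    AEStronglyMeasurable (fun τ => hamiltonianPart (H τ) (W τ)) (volume.restrict (Ici s)) := by
  have h1 : AEStronglyMeasurable H (volume.restrict (Ici s)) :=
    hH.aestronglyMeasurable.mono_measure (Measure.restrict_mono (Ici_subset_Ici.2 hs) le_rfl)
  have h2 : AEStronglyMeasurable W (volume.restrict (Ici s)) :=
    hW.aestronglyMeasurable measurableSet_Ici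
  exact ((h1.mul h2).sub (h2.mul h1)).const_smul (-Complex.I)

theorem aestronglyMeasurable_lindbladian (hH : IsBoundedHamiltonian H c)
    (L : Fin m → Matrix (Fin d) (Fin d) ℂ) {s : ℝ} (hs : 0 ≤ s)
    {W : ℝ → Matrix (Fin d) (Fin d) ℂ} (hW : ContinuousOn W (Ici s)) :
    AEStronglyMeasurable (fun τ => lindbladian (H τ) L (W τ)) (volume.restrict (Ici s)) := by
  have h2 : ContinuousOn (fun τ => (∑ j, jumpDissipator (L j)) (W τ)) (Ici s) :=
    (LinearMap.continuous_of_finiteDimensional (∑ j, jumpDissipator (L j))).comp_continuousOn hW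
  exact (hH.aestronglyMeasurable_hamiltonianPart hs hW).add
    (h2.aestronglyMeasurable measurableSet_Ici)

theorem norm_lindbladian_le (hH : IsBoundedHamiltonian H c)
    (L : Fin m → Matrix (Fin d) (Fin d) ℂ) {τ : ℝ} (hτ : 0 ≤ τ) (X : Matrix (Fin d) (Fin d) ℂ) :
    ‖lindbladian (H τ) L X‖ ≤ (2 * c + ∑ j, 2 * ‖L j‖ ^ 2) * ‖X‖ :=
  (DrivenLindblad.norm_lindbladian_le _ L X).trans
    (by gcongr; exact hH.norm_le τ hτ)

theorem intervalIntegrable_lindbladian (hH : IsBoundedHamiltonian H c)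
    (L : Fin m → Matrix (Fin d) (Fin d) ℂ) {s a b : ℝ} (hs : 0 ≤ s) (ha : s ≤ a) (hab : a ≤ b)
    {W : ℝ → Matrix (Fin d) (Fin d) ℂ} (hW : ContinuousOn W (Ici s)) :
    IntervalIntegrable (fun τ => lindbladian (H τ) L (W τ)) volume a b := by
  obtain ⟨R, hR⟩ := isCompact_Icc.exists_bound_of_continuousOn
    (hW.mono (fun x (hx : x ∈ Icc a b) => ha.trans hx.1))
  have hc := hH.nonneg
  refine intervalIntegrable_of_norm_le (C := (2 * c + ∑ j, 2 * ‖L j‖ ^ 2) * R)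
    (hH.aestronglyMeasurable_lindbladian L hs hW) ha hab fun τ hτ => ?_
  refine (hH.norm_lindbladian_le L (hs.trans (ha.trans hτ.1)) _).trans ?_
  exact mul_le_mul_of_nonneg_left (hR τ hτ) (by positivity)

end IsBoundedHamiltonian

namespace IsSolution

variable {H : ℝ → Matrix (Fin d) (Fin d) ℂ} {L : Fin m → Matrix (Fin d) (Fin d) ℂ} {c s : ℝ}
  {g W : ℝ → Matrix (Fin d) (Fin d) ℂ}

theorem eq_add_integral_of_le (hW : IsSolution H L g s W) (hH : IsBoundedHamiltonian H c)
    (hs : 0 ≤ s) (hg : ∀ a b, s ≤ a → a ≤ b → IntervalIntegrable g volume a b)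
    {a b : ℝ} (ha : s ≤ a) (hab : a ≤ b) :
    W b = W a + ∫ τ in a..b, (lindbladian (H τ) L (W τ) + g τ) := by
  have hint : ∀ a b, s ≤ a → a ≤ b →
      IntervalIntegrable (fun τ => lindbladian (H τ) L (W τ) + g τ) volume a b := fun a b ha hab =>
    (hH.intervalIntegrable_lindbladian L hs ha hab hW.continuousOn).add (hg a b ha hab)
  rw [hW.eq_add_integral b (ha.trans hab), hW.eq_add_integral a ha, add_assoc,
    intervalIntegral.integral_add_adjacent_intervals (hint s a le_rfl ha) (hint a b ha hab)]

theorem mono (hW : IsSolution H L g s W) (hH : IsBoundedHamiltonian H c)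
    (hs : 0 ≤ s) (hg : ∀ a b, s ≤ a → a ≤ b → IntervalIntegrable g volume a b)
    {r : ℝ} (hr : s ≤ r) : IsSolution H L g r W :=
  ⟨hW.continuousOn.mono (Ici_subset_Ici.2 hr),
    fun _ ht => hW.eq_add_integral_of_le hH hs hg hr ht⟩

/-- The increment of the trace norm along an inhomogeneous Lindblad equation is bounded by the
integral of the trace norm of the inhomogeneity. -/
theorem traceNorm_le_add_integral (hW : IsSolution H L g s W) (hH : IsBoundedHamiltonian H c)
    (hs : 0 ≤ s) (hg : ∀ a b, s ≤ a → a ≤ b → IntervalIntegrable g volume a b)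
    {a b G : ℝ} (ha : s ≤ a) (hab : a ≤ b) (hG : ∀ τ ∈ Icc a b, ‖g τ‖ ≤ G)
    {φ : ℝ → ℝ} (hφ : Continuous φ) (hgφ : ∀ τ ∈ Icc a b, traceNorm (g τ) ≤ φ τ) :
    traceNorm (W b) ≤ traceNorm (W a) + ∫ τ in a..b, φ τ := by
  obtain ⟨R, hR⟩ := isCompact_Icc.exists_bound_of_continuousOn
    (hW.continuousOn.mono (fun x (hx : x ∈ Icc a b) => ha.trans hx.1))
  have hc := hH.nonneg
  have hR0 : 0 ≤ R := (norm_nonneg _).trans (hR a (left_mem_Icc.2 hab))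
  have hG0 : 0 ≤ G := (norm_nonneg _).trans (hG a (left_mem_Icc.2 hab))
  obtain ⟨M, hM⟩ : ∃ M, M = 2 * c + ∑ j, 2 * ‖L j‖ ^ 2 := ⟨_, rfl⟩
  have hM0 : 0 ≤ M := by rw [hM]; positivity
  obtain ⟨p, hp⟩ : ∃ p, p = ‖∑ j, (L j)ᴴ * L j‖ := ⟨_, rfl⟩
  have hp0 : 0 ≤ p := hp ▸ norm_nonneg _
  obtain ⟨Λ, hΛ⟩ : ∃ Λ, Λ = M * R + G := ⟨_, rfl⟩
  have hΛ0 : 0 ≤ Λ := by rw [hΛ]; positivity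
  -- `Λ` bounds the right-hand side of the equation on `[a, b]`, hence is a Lipschitz constant for
  -- `W`.
  have hlip : ∀ x y, a ≤ x → x ≤ y → y ≤ b → ‖W y - W x‖ ≤ Λ * (y - x) := by
    intro x y hx hxy hy
    rw [hW.eq_add_integral_of_le hH hs hg (ha.trans hx) hxy, add_sub_cancel_left,
      ← abs_of_nonneg (sub_nonneg.2 hxy), hΛ, hM]
    refine intervalIntegral.norm_integral_le_of_norm_le_const fun τ hτ => ?_
    rw [uIoc_of_le hxy] at hτ
    have hτ' : τ ∈ Icc a b := ⟨hx.trans hτ.1.le, hτ.2.trans hy⟩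
    refine (norm_add_le _ _).trans (add_le_add ?_ (hG τ hτ'))
    exact (hH.norm_lindbladian_le L (hs.trans (ha.trans hτ'.1)) _).trans
      (mul_le_mul_of_nonneg_left (hR τ hτ') (hM ▸ hM0))
  have hstep : ∀ x y, a ≤ x → x ≤ y → y ≤ b → traceNorm (W y) - (∫ τ in a..y, φ τ) ≤
      traceNorm (W x) - (∫ τ in a..x, φ τ) +
        (2 * (c + p) ^ 2 * (d * R) + d * (M * Λ)) * (y - x) ^ 2 := by
    intro x y hx hxy hy
    have hsx := ha.trans hx
    have h0x := hs.trans hsx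
    have hδ : 0 ≤ y - x := sub_nonneg.2 hxy
    have hint1 : IntervalIntegrable (fun τ => lindbladian (H τ) L (W x)) volume x y :=
      hH.intervalIntegrable_lindbladian L hs hsx hxy continuousOn_const
    have hint2 : IntervalIntegrable (fun τ => lindbladian (H τ) L (W τ - W x)) volume x y :=
      hH.intervalIntegrable_lindbladian L hs hsx hxy (hW.continuousOn.sub continuousOn_const)
    have hint3 := hg x y hsx hxy
    -- Freeze `W` at `x`: the first bracket is an exact Euler step, the middle integral is quadratic
    -- in `y - x` by the Lipschitz bound, and the last is the source.
    have hsplit : W y = (W x + ∫ τ in x..y, lindbladian (H τ) L (W x)) +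
        (∫ τ in x..y, lindbladian (H τ) L (W τ - W x)) + ∫ τ in x..y, g τ := by
      rw [hW.eq_add_integral_of_le hH hs hg hsx hxy, add_assoc, add_assoc,
        ← intervalIntegral.integral_add hint2 hint3,
        ← intervalIntegral.integral_add hint1 (hint2.add hint3)]
      congr 1
      refine intervalIntegral.integral_congr fun τ _ => ?_
      simp only [map_sub]
      abel
    have hHint := hH.intervalIntegrable h0x hxy
    have hfrozen : ∫ τ in x..y, lindbladian (H τ) L (W x) =
        hamiltonianPart (∫ τ in x..y, H τ) (W x) +
          ((y - x : ℝ) : ℂ) • ∑ j, jumpDissipator (L j) (W x) := by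
      simp only [lindbladian_apply]
      rw [intervalIntegral.integral_add, hamiltonianPart_integral hHint,
        intervalIntegral.integral_const, Complex.coe_smul]
      · have := hint1.sub (intervalIntegrable_const (c := ∑ j, jumpDissipator (L j) (W x)))
        simpa only [lindbladian_apply, Pi.sub_apply, add_sub_cancel_right] using this
      · exact intervalIntegrable_const
    have hherm : (∫ τ in x..y, H τ).IsHermitian := by
      rw [Matrix.IsHermitian, conjTranspose_integral hHint]
      refine intervalIntegral.integral_congr fun τ hτ => ?_
      rw [uIcc_of_le hxy] at hτ
      exact hH.isHermitian τ (h0x.trans hτ.1)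
    have hHnorm : ‖∫ τ in x..y, H τ‖ ≤ c * (y - x) := by
      rw [← abs_of_nonneg hδ]
      refine intervalIntegral.norm_integral_le_of_norm_le_const fun τ hτ => ?_
      rw [uIoc_of_le hxy] at hτ
      exact hH.norm_le τ (h0x.trans hτ.1.le)
    have hWx : traceNorm (W x) ≤ d * R := (traceNorm_le_card_mul_norm _).trans
      (mul_le_mul_of_nonneg_left (hR x ⟨hx, hxy.trans hy⟩) d.cast_nonneg)
    have h1 : traceNorm (W x + ∫ τ in x..y, lindbladian (H τ) L (W x)) ≤
        traceNorm (W x) + 2 * (c + p) ^ 2 * (d * R) * (y - x) ^ 2 := by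
      rw [hfrozen, ← add_assoc]
      refine (traceNorm_euler_step_le hherm L hδ (W x)).trans ?_
      have h2 : (‖∫ τ in x..y, H τ‖ + (y - x) * p) ^ 2 ≤ ((c + p) * (y - x)) ^ 2 := by
        refine pow_le_pow_left₀ (by positivity) ?_ 2
        linarith
      have h3 : (‖∫ τ in x..y, H τ‖ + (y - x) * p) ^ 2 * traceNorm (W x) ≤
          ((c + p) * (y - x)) ^ 2 * (d * R) :=
        mul_le_mul h2 hWx (traceNorm_nonneg _) (by positivity)
      rw [← hp]
      linarith
    have h2 : traceNorm (∫ τ in x..y, lindbladian (H τ) L (W τ - W x)) ≤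
        d * (M * Λ) * (y - x) ^ 2 := by
      refine (traceNorm_le_card_mul_norm _).trans ?_
      have h3 : ‖∫ τ in x..y, lindbladian (H τ) L (W τ - W x)‖ ≤
          (M * (Λ * (y - x))) * |y - x| := by
        refine intervalIntegral.norm_integral_le_of_norm_le_const fun τ hτ => ?_
        rw [uIoc_of_le hxy] at hτ
        refine (hH.norm_lindbladian_le L (h0x.trans hτ.1.le) _).trans ?_
        rw [← hM]
        refine (mul_le_mul_of_nonneg_left ?_ hM0)
        refine (hlip x τ hx hτ.1.le (hτ.2.trans hy)).trans (mul_le_mul_of_nonneg_left ?_ hΛ0)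
        linarith [hτ.2]
      rw [abs_of_nonneg hδ] at h3
      calc _ ≤ (d : ℝ) * ((M * (Λ * (y - x))) * (y - x)) :=
            mul_le_mul_of_nonneg_left h3 d.cast_nonneg
        _ = _ := by ring
    have h3 : traceNorm (∫ τ in x..y, g τ) ≤ ∫ τ in x..y, φ τ :=
      traceNorm_integral_le hxy hint3 (hφ.intervalIntegrable _ _)
        fun τ hτ => hgφ τ ⟨hx.trans hτ.1.le, hτ.2.trans hy⟩
    have h4 : (∫ τ in a..x, φ τ) + ∫ τ in x..y, φ τ = ∫ τ in a..y, φ τ :=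
      intervalIntegral.integral_add_adjacent_intervals (hφ.intervalIntegrable _ _)
        (hφ.intervalIntegrable _ _)
    have h5 : traceNorm (W y) ≤ traceNorm (W x + ∫ τ in x..y, lindbladian (H τ) L (W x)) +
        traceNorm (∫ τ in x..y, lindbladian (H τ) L (W τ - W x)) +
          traceNorm (∫ τ in x..y, g τ) := by
      conv_lhs => rw [hsplit]
      exact (traceNorm_add_le _ _).trans (add_le_add_left (traceNorm_add_le _ _) _)
    linarith
  have h := le_of_forall_le_add_mul_sq hab hstep
  rw [intervalIntegral.integral_same] at h
  linarith

/-- The trace norm does not increase along a homogeneous Lindblad equation. -/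
theorem traceNorm_antitone (hW : IsSolution H L 0 s W) (hH : IsBoundedHamiltonian H c)
    (hs : 0 ≤ s) {a b : ℝ} (ha : s ≤ a) (hab : a ≤ b) : traceNorm (W b) ≤ traceNorm (W a) := by
  have h := hW.traceNorm_le_add_integral hH hs
    (fun _ _ _ _ => (intervalIntegrable_const (c := (0 : Matrix (Fin d) (Fin d) ℂ)))) ha hab
    (G := 0) (fun τ _ => by simp) (φ := fun _ => 0) continuous_const
    (fun τ _ => by simp [traceNorm_zero])
  simpa using h

theorem sub {g' W' : ℝ → Matrix (Fin d) (Fin d) ℂ} (hW : IsSolution H L g s W)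
    (hW' : IsSolution H L g' s W') (hH : IsBoundedHamiltonian H c) (hs : 0 ≤ s)
    (hg : ∀ a b, s ≤ a → a ≤ b → IntervalIntegrable g volume a b)
    (hg' : ∀ a b, s ≤ a → a ≤ b → IntervalIntegrable g' volume a b) :
    IsSolution H L (g - g') s (W - W') := by
  refine ⟨hW.continuousOn.sub hW'.continuousOn, fun t ht => ?_⟩
  rw [Pi.sub_apply, hW.eq_add_integral t ht, hW'.eq_add_integral t ht, add_sub_add_comm,
    ← intervalIntegral.integral_sub
      ((hH.intervalIntegrable_lindbladian L hs le_rfl ht hW.continuousOn).add (hg s t le_rfl ht))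
      ((hH.intervalIntegrable_lindbladian L hs le_rfl ht hW'.continuousOn).add
        (hg' s t le_rfl ht))]
  congr 1
  refine intervalIntegral.integral_congr fun τ _ => ?_
  simp only [Pi.sub_apply, map_sub]
  abel

end IsSolution

end Solutions

/-! ### The Dyson series as a solution; conserved quantities. -/

section Dyson

open MeasureTheory Set Filter Topology

variable {d m : ℕ}

theorem dysonTerm_smul (𝓛 : ℝ → Matrix (Fin d) (Fin d) ℂ →ₗ[ℂ] Matrix (Fin d) (Fin d) ℂ)
    (s : ℝ) (c : ℂ) (X : Matrix (Fin d) (Fin d) ℂ) (n : ℕ) (t : ℝ) :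
    dysonTerm 𝓛 s (c • X) n t = c • dysonTerm 𝓛 s X n t := by
  induction n generalizing t with
  | zero => rfl
  | succ n ih => simp only [dysonTerm, ih, map_smul, intervalIntegral.integral_smul]

theorem timeEvolution_smul (𝓛 : ℝ → Matrix (Fin d) (Fin d) ℂ →ₗ[ℂ] Matrix (Fin d) (Fin d) ℂ)
    (t s : ℝ) (c : ℂ) (X : Matrix (Fin d) (Fin d) ℂ) :
    timeEvolution 𝓛 t s (c • X) = c • timeEvolution 𝓛 t s X := by
  simp only [timeEvolution, dysonTerm_smul, tsum_const_smul'']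

theorem timeEvolution_self (𝓛 : ℝ → Matrix (Fin d) (Fin d) ℂ →ₗ[ℂ] Matrix (Fin d) (Fin d) ℂ)
    (s : ℝ) (X : Matrix (Fin d) (Fin d) ℂ) : timeEvolution 𝓛 s s X = X := by
  rw [timeEvolution, tsum_eq_single 0]
  · rfl
  · intro n hn
    obtain ⟨k, rfl⟩ := Nat.exists_eq_succ_of_ne_zero hn
    simp [dysonTerm]

theorem continuousOn_Ici_of_forall_Icc {E : Type*} [TopologicalSpace E] {f : ℝ → E} {s : ℝ}
    (h : ∀ b, s ≤ b → ContinuousOn f (Icc s b)) : ContinuousOn f (Ici s) := by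
  intro t (ht : s ≤ t)
  refine (h (t + 1) (by linarith) t ⟨ht, by linarith⟩).mono_of_mem_nhdsWithin ?_
  exact inter_mem self_mem_nhdsWithin (mem_nhdsWithin_of_mem_nhds (Iic_mem_nhds (by linarith)))

theorem continuousOn_primitive_Ici {E : Type*} [NormedAddCommGroup E] [NormedSpace ℝ E]
    {f : ℝ → E} {s : ℝ} (h : ∀ b, s ≤ b → IntervalIntegrable f volume s b) :
    ContinuousOn (fun t => ∫ τ in s..t, f τ) (Ici s) := by
  refine continuousOn_Ici_of_forall_Icc fun b hb => ?_
  rw [← uIcc_of_le hb]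
  exact intervalIntegral.continuousOn_primitive_interval
    ((intervalIntegrable_iff' (by simp)).1 (h b hb))

theorem integral_mul_sub_pow_div_factorial (M s t : ℝ) (n : ℕ) :
    ∫ τ in s..t, M * ((M * (τ - s)) ^ n / n.factorial) =
      (M * (t - s)) ^ (n + 1) / (n + 1).factorial := by
  have h := intervalIntegral.integral_comp_sub_right
    (fun x => M * ((M * x) ^ n / n.factorial)) s (a := s) (b := t)
  rw [h]
  have h2 : ∀ x : ℝ, M * ((M * x) ^ n / n.factorial) = M ^ (n + 1) / n.factorial * x ^ n :=
    fun x => by ring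
  simp only [h2, sub_self]
  rw [intervalIntegral.integral_const_mul, integral_pow, Nat.factorial_succ,
    mul_pow M (t - s)]
  push_cast
  have h3 : (n.factorial : ℝ) ≠ 0 := by positivity
  field_simp
  ring

variable {H : ℝ → Matrix (Fin d) (Fin d) ℂ} {c s : ℝ}

/-- Continuity is carried in the same induction because it makes the next integrand integrable. -/
theorem IsBoundedHamiltonian.dysonTerm_bound (hH : IsBoundedHamiltonian H c)
    (L : Fin m → Matrix (Fin d) (Fin d) ℂ) (hs : 0 ≤ s) (X : Matrix (Fin d) (Fin d) ℂ) (n : ℕ) :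
    ContinuousOn (dysonTerm (fun τ => lindbladian (H τ) L) s X n) (Ici s) ∧
      ∀ t, s ≤ t → ‖dysonTerm (fun τ => lindbladian (H τ) L) s X n t‖ ≤
        ((2 * c + ∑ j, 2 * ‖L j‖ ^ 2) * (t - s)) ^ n / n.factorial * ‖X‖ := by
  have hc := hH.nonneg
  obtain ⟨M, hM⟩ : ∃ M, M = 2 * c + ∑ j, 2 * ‖L j‖ ^ 2 := ⟨_, rfl⟩
  have hM0 : 0 ≤ M := by rw [hM]; positivity
  rw [← hM]
  induction n with
  | zero =>
    refine ⟨continuousOn_const, fun t _ => ?_⟩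
    simp [dysonTerm]
  | succ n ih =>
    refine ⟨continuousOn_primitive_Ici fun b hb =>
      hH.intervalIntegrable_lindbladian L hs le_rfl hb ih.1, fun t ht => ?_⟩
    rw [← integral_mul_sub_pow_div_factorial, ← intervalIntegral.integral_mul_const]
    refine intervalIntegral.norm_integral_le_of_norm_le ht (ae_of_all _ fun τ hτ => ?_)
      (Continuous.intervalIntegrable (by fun_prop) _ _)
    refine (hH.norm_lindbladian_le L (hs.trans hτ.1.le) _).trans ?_
    rw [← hM, mul_assoc]
    exact mul_le_mul_of_nonneg_left (ih.2 τ hτ.1.le) hM0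

/-- The Dyson series solves the Lindblad equation. -/
theorem IsBoundedHamiltonian.isSolution_timeEvolution (hH : IsBoundedHamiltonian H c)
    (L : Fin m → Matrix (Fin d) (Fin d) ℂ) (hs : 0 ≤ s) (X : Matrix (Fin d) (Fin d) ℂ) :
    IsSolution H L 0 s (fun t => timeEvolution (fun τ => lindbladian (H τ) L) t s X) := by
  have hc := hH.nonneg
  have hb := hH.dysonTerm_bound L hs X
  obtain ⟨M, hM⟩ : ∃ M, M = 2 * c + ∑ j, 2 * ‖L j‖ ^ 2 := ⟨_, rfl⟩
  have hM0 : 0 ≤ M := by rw [hM]; positivity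
  rw [← hM] at hb
  set D := dysonTerm (fun τ => lindbladian (H τ) L) s X with hD
  have hbt : ∀ n t τ, s ≤ τ → τ ≤ t → ‖D n τ‖ ≤ (M * (t - s)) ^ n / n.factorial * ‖X‖ := by
    intro n t τ hsτ hτt
    refine ((hb n).2 τ hsτ).trans ?_
    have : 0 ≤ τ - s := sub_nonneg.2 hsτ
    gcongr
  have hsum : ∀ t, Summable fun n : ℕ => (M * (t - s)) ^ n / n.factorial * ‖X‖ :=
    fun t => (Real.summable_pow_div_factorial _).mul_right _
  have hDsum : ∀ t, s ≤ t → Summable fun n => D n t := fun t ht =>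
    Summable.of_norm_bounded (hsum t) fun n => hbt n t t ht le_rfl
  refine ⟨continuousOn_Ici_of_forall_Icc fun t ht => continuousOn_tsum
    (fun n => (hb n).1.mono Icc_subset_Ici_self) (hsum t)
    fun n τ hτ => hbt n t τ hτ.1 hτ.2, fun t ht => ?_⟩
  -- Dominated convergence moves the series through the integral; what results is the Dyson series
  -- without its zeroth term.
  have hint : HasSum (fun n => ∫ τ in s..t, lindbladian (H τ) L (D n τ))
      (∫ τ in s..t, lindbladian (H τ) L (timeEvolution (fun τ => lindbladian (H τ) L) τ s X)) := by
    refine intervalIntegral.hasSum_integral_of_dominated_convergence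
      (fun n _ => M * ((M * (t - s)) ^ n / n.factorial * ‖X‖)) (fun n => ?_)
      (fun n => ae_of_all _ fun τ hτ => ?_) (ae_of_all _ fun τ _ => (hsum t).mul_left M)
      intervalIntegrable_const (ae_of_all _ fun τ hτ => ?_)
    · exact (hH.aestronglyMeasurable_lindbladian L hs (hb n).1).mono_measure
        (Measure.restrict_mono (uIoc_subset_Ici le_rfl ht) le_rfl)
    · rw [uIoc_of_le ht] at hτ
      refine (hH.norm_lindbladian_le L (hs.trans hτ.1.le) _).trans ?_
      rw [← hM]
      exact mul_le_mul_of_nonneg_left (hbt n t τ hτ.1.le hτ.2) hM0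
    · rw [uIoc_of_le ht] at hτ
      exact (hDsum τ hτ.1.le).hasSum.map (lindbladian (H τ) L)
        (LinearMap.continuous_of_finiteDimensional (lindbladian (H τ) L))
  rw [timeEvolution_self]
  simp only [Pi.zero_apply, add_zero]
  rw [← hint.tsum_eq]
  exact (hDsum t ht).tsum_eq_zero_add

theorem conjTranspose_lindbladian {H : Matrix (Fin d) (Fin d) ℂ} (hH : H.IsHermitian)
    (L : Fin m → Matrix (Fin d) (Fin d) ℂ) (X : Matrix (Fin d) (Fin d) ℂ) :
    (lindbladian H L X)ᴴ = lindbladian H L Xᴴ := by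
  have h1 : (hamiltonianPart H X)ᴴ = hamiltonianPart H Xᴴ := by
    simp only [hamiltonianPart_apply, Matrix.conjTranspose_smul, Matrix.conjTranspose_sub,
      Matrix.conjTranspose_mul, hH.eq]
    rw [star_neg, Complex.star_def, Complex.conj_I]
    module
  have h2 : ∀ j, (jumpDissipator (L j) X)ᴴ = jumpDissipator (L j) Xᴴ := by
    intro j
    simp only [jumpDissipator_apply, Matrix.conjTranspose_smul, Matrix.conjTranspose_sub,
      Matrix.conjTranspose_add, Matrix.conjTranspose_mul, Matrix.conjTranspose_conjTranspose]
    simp [mul_assoc, add_comm]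
  rw [lindbladian_apply, lindbladian_apply, Matrix.conjTranspose_add, Matrix.conjTranspose_sum, h1]
  simp only [h2]

theorem trace_lindbladian (H : Matrix (Fin d) (Fin d) ℂ)
    (L : Fin m → Matrix (Fin d) (Fin d) ℂ) (X : Matrix (Fin d) (Fin d) ℂ) :
    (lindbladian H L X).trace = 0 := by
  have h1 : (hamiltonianPart H X).trace = 0 := by
    rw [hamiltonianPart_apply, Matrix.trace_smul, Matrix.trace_sub, Matrix.trace_mul_comm, sub_self,
      smul_zero]
  have h2 : ∀ j, (jumpDissipator (L j) X).trace = 0 := by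
    intro j
    rw [jumpDissipator_apply, Matrix.trace_sub, Matrix.trace_smul, Matrix.trace_add,
      Matrix.trace_mul_comm X, Matrix.trace_mul_cycle, smul_eq_mul]
    ring
  rw [lindbladian_apply, Matrix.trace_add, Matrix.trace_sum, h1]
  simp [h2]

theorem IsSolution.trace_eq {L : Fin m → Matrix (Fin d) (Fin d) ℂ}
    {W : ℝ → Matrix (Fin d) (Fin d) ℂ} (hW : IsSolution H L 0 s W)
    (hH : IsBoundedHamiltonian H c) (hs : 0 ≤ s) {t : ℝ} (ht : s ≤ t) :
    (W t).trace = (W s).trace := by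
  rw [hW.eq_add_integral t ht]
  simp only [Pi.zero_apply, add_zero]
  rw [Matrix.trace_add, trace_integral
    (hH.intervalIntegrable_lindbladian L hs le_rfl ht hW.continuousOn)]
  simp [trace_lindbladian]

/-- `W†` solves the same equation with the same initial value, and trace-norm monotonicity applied
to `W† - W` gives uniqueness. -/
theorem IsSolution.isHermitian {L : Fin m → Matrix (Fin d) (Fin d) ℂ}
    {W : ℝ → Matrix (Fin d) (Fin d) ℂ} (hW : IsSolution H L 0 s W)
    (hH : IsBoundedHamiltonian H c) (hs : 0 ≤ s) (h0 : (W s).IsHermitian) {t : ℝ} (ht : s ≤ t) :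
    (W t).IsHermitian := by
  have hW' : IsSolution H L 0 s (fun t => (W t)ᴴ) := by
    refine ⟨hW.continuousOn.star, fun t ht => ?_⟩
    simp only [Pi.zero_apply, add_zero]
    conv_lhs => rw [hW.eq_add_integral t ht]
    simp only [Pi.zero_apply, add_zero]
    rw [Matrix.conjTranspose_add, conjTranspose_integral
      (hH.intervalIntegrable_lindbladian L hs le_rfl ht hW.continuousOn)]
    congr 1
    refine intervalIntegral.integral_congr fun τ hτ => ?_
    rw [uIcc_of_le ht] at hτ
    exact conjTranspose_lindbladian (hH.isHermitian τ (hs.trans hτ.1)) L _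
  have hzero : ∀ a b : ℝ, s ≤ a → a ≤ b →
      IntervalIntegrable (0 : ℝ → Matrix (Fin d) (Fin d) ℂ) volume a b :=
    fun _ _ _ _ => intervalIntegrable_const (c := (0 : Matrix (Fin d) (Fin d) ℂ))
  have hsub := hW'.sub hW hH hs hzero hzero
  rw [sub_zero] at hsub
  have h := hsub.traceNorm_antitone hH hs le_rfl ht
  simp only [Pi.sub_apply, h0.eq, sub_self, traceNorm_zero] at h
  exact sub_eq_zero.1 (eq_zero_of_traceNorm_eq_zero (h.antisymm (traceNorm_nonneg _)))

end Dyson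

/-! ### From the contraction hypothesis to decay of the driven evolution. -/

section Contraction

open MeasureTheory Set Filter Topology

variable {d m : ℕ}

open scoped MatrixOrder in
theorem posSemidef_smul_one_add {X : Matrix (Fin d) (Fin d) ℂ} (hX : X.IsHermitian) :
    ((‖X‖ : ℂ) • (1 : Matrix (Fin d) (Fin d) ℂ) + X).PosSemidef := by
  have h := IsSelfAdjoint.neg_algebraMap_norm_le_self (a := X) hX
  rw [Matrix.le_iff, sub_neg_eq_add, Algebra.algebraMap_eq_smul_one, add_comm] at h
  rwa [Complex.coe_smul]

theorem IsState.isHermitian_sub {ρ σ : Matrix (Fin d) (Fin d) ℂ} (hρ : IsState ρ)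
    (hσ : IsState σ) : (ρ - σ).IsHermitian := hρ.1.isHermitian.sub hσ.1.isHermitian

theorem IsState.trace_sub {ρ σ : Matrix (Fin d) (Fin d) ℂ} (hρ : IsState ρ)
    (hσ : IsState σ) : (ρ - σ).trace = 0 := by
  rw [Matrix.trace_sub, hρ.2, hσ.2, sub_self]

/-- Every traceless Hermitian matrix is proportional to a difference of two states. -/
theorem exists_isState_sub_eq_smul {X : Matrix (Fin d) (Fin d) ℂ} (hX : X.IsHermitian)
    (htr : X.trace = 0) (hd : d ≠ 0) :
    ∃ (ρ σ : Matrix (Fin d) (Fin d) ℂ) (ε : ℝ), 0 < ε ∧ IsState ρ ∧ IsState σ ∧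
      ρ - σ = (ε : ℂ) • X := by
  have hd' : (0 : ℝ) < d := by exact_mod_cast Nat.pos_of_ne_zero hd
  have hdc : (d : ℂ) ≠ 0 := by exact_mod_cast hd
  obtain ⟨r, hr⟩ : ∃ r : ℝ, r = ‖X‖ + 1 := ⟨_, rfl⟩
  have hr0 : 0 < r := by rw [hr]; positivity
  have hrc : (r : ℂ) ≠ 0 := by exact_mod_cast hr0.ne'
  have hpsd : ((r : ℂ) • (1 : Matrix (Fin d) (Fin d) ℂ) + X).PosSemidef := by
    have h := (posSemidef_smul_one_add hX).add (Matrix.PosSemidef.one (n := Fin d) (R := ℂ))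
    convert h using 1
    rw [hr]
    push_cast
    module
  -- Perturb the maximally mixed state: `ρ = 1/d + X/(dr)`, `σ = 1/d`. Taking `r = ‖X‖ + 1` keeps
  -- `r` positive even for `X = 0`.
  refine ⟨((d * r : ℝ) : ℂ)⁻¹ • ((r : ℂ) • 1 + X), (d : ℂ)⁻¹ • 1, (d * r)⁻¹, by positivity,
    ⟨hpsd.smul ?_, ?_⟩, ⟨Matrix.PosSemidef.one.smul ?_, ?_⟩, ?_⟩
  · rw [← Complex.ofReal_inv]
    exact Complex.zero_le_real.2 (by positivity)
  · simp only [Matrix.trace_smul, Matrix.trace_add, htr, Matrix.trace_one, Fintype.card_fin]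
    push_cast
    simp only [smul_eq_mul, add_zero]
    field_simp
  · rw [← Complex.ofReal_natCast, ← Complex.ofReal_inv]
    exact Complex.zero_le_real.2 (by positivity)
  · simp only [Matrix.trace_smul, Matrix.trace_one, Fintype.card_fin, smul_eq_mul]
    field_simp
  · push_cast
    rw [smul_add, smul_smul, mul_inv, mul_assoc, inv_mul_cancel₀ hrc, mul_one, add_sub_cancel_left]

/-- Both sides are homogeneous, so the bound extends from differences of states to their multiples.
For `d = 0` there are no states, but all matrices vanish. -/
theorem ContractsWith.traceNorm_timeEvolution_le
    {𝓛 : ℝ → Matrix (Fin d) (Fin d) ℂ →ₗ[ℂ] Matrix (Fin d) (Fin d) ℂ} {K γ : ℝ}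
    (h : ContractsWith 𝓛 K γ) {X : Matrix (Fin d) (Fin d) ℂ} (hX : X.IsHermitian)
    (htr : X.trace = 0) {s t : ℝ} (hs : 0 ≤ s) (ht : s ≤ t) :
    traceNorm (timeEvolution 𝓛 t s X) ≤ K * Real.exp (-γ * (t - s)) * traceNorm X := by
  rcases eq_or_ne d 0 with rfl | hd
  · rw [Subsingleton.elim X 0, Subsingleton.elim (timeEvolution 𝓛 t s 0) 0, traceNorm_zero,
      mul_zero]
  obtain ⟨ρ, σ, ε, hε, hρ, hσ, heq⟩ := exists_isState_sub_eq_smul hX htr hd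
  have h1 := h ρ σ hρ hσ s t hs ht
  rw [heq, timeEvolution_smul, traceNorm_smul, traceNorm_smul, Complex.norm_real,
    Real.norm_of_nonneg hε.le, abs_of_nonneg (sub_nonneg.2 ht)] at h1
  refine le_of_mul_le_mul_left ?_ hε
  linarith

theorem integral_const_mul_exp_le {A γ s a b : ℝ} (hA : 0 ≤ A) (hγ : 0 < γ) :
    ∫ τ in a..b, A * Real.exp (-γ * (τ - s)) ≤ A * Real.exp (-γ * (a - s)) / γ := by
  have hderiv : ∀ τ ∈ uIcc a b, HasDerivAt (fun τ => -(A / γ) * Real.exp (-γ * (τ - s)))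
      (A * Real.exp (-γ * (τ - s))) τ := by
    intro τ _
    have h1 : HasDerivAt (fun τ => -γ * (τ - s)) (-γ * 1) τ :=
      ((hasDerivAt_id τ).sub_const s).const_mul (-γ)
    have h2 : -(A / γ) * (Real.exp (-γ * (τ - s)) * (-γ * 1)) = A * Real.exp (-γ * (τ - s)) := by
      field_simp
    exact h2 ▸ h1.exp.const_mul (-(A / γ))
  rw [intervalIntegral.integral_eq_sub_of_hasDerivAt hderiv
    (Continuous.intervalIntegrable (by fun_prop) _ _)]
  have h2 : 0 ≤ A / γ * Real.exp (-γ * (b - s)) := by positivity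
  have h3 : A * Real.exp (-γ * (a - s)) / γ = A / γ * Real.exp (-γ * (a - s)) := by ring
  rw [h3]
  linarith

theorem isBoundedHamiltonian_const {H₀ : Matrix (Fin d) (Fin d) ℂ} (hH₀ : H₀.IsHermitian) :
    IsBoundedHamiltonian (fun _ => H₀) ‖H₀‖ :=
  ⟨fun _ _ => hH₀, fun _ _ => le_rfl, aestronglyMeasurable_const⟩

theorem IsBoundedHamiltonian.add {H V : ℝ → Matrix (Fin d) (Fin d) ℂ} {c v : ℝ}
    (hH : IsBoundedHamiltonian H c) (hV : IsBoundedHamiltonian V v) :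
    IsBoundedHamiltonian (fun t => H t + V t) (c + v) :=
  ⟨fun t ht => (hH.isHermitian t ht).add (hV.isHermitian t ht),
    fun t ht => (norm_add_le _ _).trans (add_le_add (hH.norm_le t ht) (hV.norm_le t ht)),
    hH.aestronglyMeasurable.add hV.aestronglyMeasurable⟩

variable {H₀ : Matrix (Fin d) (Fin d) ℂ} {L : Fin m → Matrix (Fin d) (Fin d) ℂ}
  {V : ℝ → Matrix (Fin d) (Fin d) ℂ} {K γ v : ℝ}

/-- The distance between the driven and the undriven evolution after time `T`, when the latter
contracts exponentially with constant `K = exp (γ * T₁)`. -/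
theorem IsSolution.traceNorm_le_of_contractsWith (hH₀ : H₀.IsHermitian)
    (hV : IsBoundedHamiltonian V v) (hγ : 0 < γ)
    (hcontr : ContractsWith (fun _ : ℝ => lindbladian H₀ L) K γ) {T₁ T : ℝ} (hT₁ : 0 ≤ T₁)
    (hT : T₁ ≤ T) (hK : K * Real.exp (-γ * T₁) = 1) {s : ℝ} (hs : 0 ≤ s)
    {Y : ℝ → Matrix (Fin d) (Fin d) ℂ} (hY : IsSolution (fun t => H₀ + V t) L 0 s Y)
    (hYh : (Y s).IsHermitian) (hYtr : (Y s).trace = 0) :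
    traceNorm (Y (s + T)) ≤
      (K * Real.exp (-γ * T) + 2 * v * T₁ + 2 * v / γ) * traceNorm (Y s) := by
  have hH₀b := isBoundedHamiltonian_const hH₀
  have hH := hH₀b.add hV
  have hv := hV.nonneg
  have hN := traceNorm_nonneg (Y s)
  have hK0 : 0 ≤ K := by
    by_contra hneg
    have := mul_neg_of_neg_of_pos (not_le.1 hneg) (Real.exp_pos (-γ * T₁))
    linarith
  set Z := fun t => timeEvolution (fun _ : ℝ => lindbladian H₀ L) t s (Y s) with hZdef
  have hZ : IsSolution (fun _ => H₀) L 0 s Z := hH₀b.isSolution_timeEvolution L hs (Y s)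
  have hZs : Z s = Y s := timeEvolution_self _ _ _
  have hZdecay : ∀ τ, s ≤ τ → traceNorm (Z τ) ≤ K * Real.exp (-γ * (τ - s)) * traceNorm (Y s) :=
    fun τ hτ => hcontr.traceNorm_timeEvolution_le hYh hYtr hs hτ
  have hZone : ∀ τ, s ≤ τ → traceNorm (Z τ) ≤ traceNorm (Y s) := fun τ hτ => by
    rw [← hZs]; exact hZ.traceNorm_antitone hH₀b hs le_rfl hτ
  set g : ℝ → Matrix (Fin d) (Fin d) ℂ := fun τ => hamiltonianPart (V τ) (Z τ) with hgdef
  have hgbound : ∀ a b, s ≤ a → ∃ G, ∀ τ ∈ Icc a b, ‖g τ‖ ≤ G := by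
    intro a b ha
    obtain ⟨R, hR⟩ := isCompact_Icc.exists_bound_of_continuousOn
      (hZ.continuousOn.mono (fun x (hx : x ∈ Icc a b) => ha.trans hx.1))
    refine ⟨2 * v * R, fun τ hτ => (norm_hamiltonianPart_le _ _).trans ?_⟩
    have h1 := hV.norm_le τ (hs.trans (ha.trans hτ.1))
    exact mul_le_mul (by linarith) (hR τ hτ) (norm_nonneg _) (by positivity)
  have hgint : ∀ a b, s ≤ a → a ≤ b → IntervalIntegrable g volume a b := by
    intro a b ha hab
    obtain ⟨G, hG⟩ := hgbound a b ha
    exact intervalIntegrable_of_norm_le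
      (hV.aestronglyMeasurable_hamiltonianPart hs hZ.continuousOn) ha hab hG
  have hgN : ∀ τ, s ≤ τ → traceNorm (g τ) ≤ 2 * v * traceNorm (Z τ) := fun τ hτ => by
    refine (traceNorm_hamiltonianPart_le _ _).trans
      (mul_le_mul_of_nonneg_right ?_ (traceNorm_nonneg _))
    linarith [hV.norm_le τ (hs.trans hτ)]
  -- `Z` also solves the driven equation, with source `-g`; subtracting it from `Y` leaves source
  -- `+g`.
  have hZ' : IsSolution (fun t => H₀ + V t) L (-g) s Z := by
    refine ⟨hZ.continuousOn, fun t ht => ?_⟩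
    rw [hZ.eq_add_integral t ht]
    congr 1
    refine intervalIntegral.integral_congr fun τ _ => ?_
    simp [lindbladian_add_apply, hgdef]
  have hW := hY.sub hZ' hH hs
    (fun _ _ _ _ => intervalIntegrable_const (c := (0 : Matrix (Fin d) (Fin d) ℂ)))
    (fun a b ha hab => (hgint a b ha hab).neg)
  rw [sub_neg_eq_add, zero_add] at hW
  -- Up to `T₁`, only `‖Z‖₁ ≤ ‖Y s‖₁` is used.
  have hW1 : traceNorm ((Y - Z) (s + T₁)) ≤ 2 * v * T₁ * traceNorm (Y s) := by
    obtain ⟨G, hG⟩ := hgbound s (s + T₁) le_rfl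
    have h := hW.traceNorm_le_add_integral hH hs hgint le_rfl (le_add_of_nonneg_right hT₁) hG
      (φ := fun _ => 2 * v * traceNorm (Y s)) continuous_const (fun τ hτ =>
        (hgN τ hτ.1).trans (mul_le_mul_of_nonneg_left (hZone τ hτ.1) (by positivity)))
    rw [Pi.sub_apply Y Z s, hZs, sub_self, traceNorm_zero, zero_add,
      intervalIntegral.integral_const, add_sub_cancel_left, smul_eq_mul] at h
    linarith
  -- Beyond `T₁`, the exponential tail integrates to at most `K e^{-γT₁}/γ = 1/γ`.
  have hW2 : traceNorm ((Y - Z) (s + T)) ≤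
      traceNorm ((Y - Z) (s + T₁)) + 2 * v / γ * traceNorm (Y s) := by
    have hs1 : s ≤ s + T₁ := le_add_of_nonneg_right hT₁
    obtain ⟨G, hG⟩ := hgbound (s + T₁) (s + T) hs1
    have h := hW.traceNorm_le_add_integral hH hs hgint hs1 (add_le_add_right hT s) hG
      (φ := fun τ => 2 * v * K * traceNorm (Y s) * Real.exp (-γ * (τ - s)))
      (by fun_prop) (fun τ hτ => by
        refine (hgN τ (hs1.trans hτ.1)).trans ((mul_le_mul_of_nonneg_left
          (hZdecay τ (hs1.trans hτ.1)) (by positivity)).trans (le_of_eq (by ring))))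
    refine h.trans (add_le_add_right ((integral_const_mul_exp_le (by positivity) hγ).trans
      (le_of_eq ?_)) _)
    rw [add_sub_cancel_left]
    calc _ = 2 * v / γ * traceNorm (Y s) * (K * Real.exp (-γ * T₁)) := by ring
      _ = _ := by rw [hK, mul_one]
  have hZT := hZdecay (s + T) (le_add_of_nonneg_right (hT₁.trans hT))
  rw [add_sub_cancel_left] at hZT
  have hYT : traceNorm (Y (s + T)) ≤ traceNorm ((Y - Z) (s + T)) + traceNorm (Z (s + T)) := by
    have h := traceNorm_add_le ((Y - Z) (s + T)) (Z (s + T))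
    rwa [Pi.sub_apply, sub_add_cancel] at h
  linarith

/-- Below the driving threshold the driven evolution is a strict contraction over some fixed
time. -/
theorem exists_uniform_contraction (hH₀ : H₀.IsHermitian) (hV : IsBoundedHamiltonian V v)
    (hK : 0 < K) (hγ : 0 < γ) (hcontr : ContractsWith (fun _ : ℝ => lindbladian H₀ L) K γ)
    (hv : v < γ / (2 + 2 * Real.log K)) :
    ∃ T q : ℝ, 0 < T ∧ 0 < q ∧ q < 1 ∧ ∀ (s : ℝ) (Y : ℝ → Matrix (Fin d) (Fin d) ℂ), 0 ≤ s →
      IsSolution (fun t => H₀ + V t) L 0 s Y → (Y s).IsHermitian → (Y s).trace = 0 →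
        traceNorm (Y (s + T)) ≤ q * traceNorm (Y s) := by
  have hv0 := hV.nonneg
  rcases le_or_gt 1 K with hK1 | hK1
  · have hlog := Real.log_nonneg hK1
    obtain ⟨T₁, hT₁⟩ : ∃ T₁, T₁ = Real.log K / γ := ⟨_, rfl⟩
    have hT₁0 : 0 ≤ T₁ := by rw [hT₁]; positivity
    have hKT₁ : K * Real.exp (-γ * T₁) = 1 := by
      have : -γ * T₁ = -Real.log K := by rw [hT₁]; field_simp
      rw [this, Real.exp_neg, Real.exp_log hK, mul_inv_cancel₀ hK.ne']
    obtain ⟨q₀, hq₀⟩ : ∃ q₀, q₀ = 2 * v * T₁ + 2 * v / γ := ⟨_, rfl⟩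
    have hq₀0 : 0 ≤ q₀ := by rw [hq₀]; positivity
    have hq₀1 : q₀ < 1 := by
      have h1 : q₀ = v * (2 + 2 * Real.log K) / γ := by rw [hq₀, hT₁]; field_simp; ring
      rw [h1, div_lt_one hγ]
      rwa [lt_div_iff₀ (by linarith)] at hv
    have hlim : Tendsto (fun T : ℝ => K * Real.exp (-γ * T)) atTop (𝓝 (K * 0)) :=
      (Real.tendsto_exp_atBot.comp
        (tendsto_id.const_mul_atTop_of_neg (neg_lt_zero.2 hγ))).const_mul K
    rw [mul_zero] at hlim
    -- Half of the gap `1 - q₀` is left for `K e^{-γT}`, so the total factor is at most `(1 +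
    -- q₀)/2`.
    obtain ⟨T, hT, hT', hT''⟩ := ((hlim.eventually_lt_const
      (show 0 < (1 - q₀) / 2 by linarith)).and
        ((eventually_ge_atTop T₁).and (eventually_gt_atTop 0))).exists
    refine ⟨T, (1 + q₀) / 2, hT'', by linarith, by linarith, fun s Y hs hY hYh hYtr => ?_⟩
    refine (hY.traceNorm_le_of_contractsWith hH₀ hV hγ hcontr hT₁0 hT' hKT₁ hs hYh hYtr).trans
      (mul_le_mul_of_nonneg_right ?_ (traceNorm_nonneg _))
    linarith
  -- For `K < 1`, contraction at elapsed time `0` forces `Y s = 0`, so any `T` and `q` work.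
  · refine ⟨1, 1 / 2, one_pos, by norm_num, by norm_num, fun s Y hs hY hYh hYtr => ?_⟩
    have h1 := hcontr.traceNorm_timeEvolution_le hYh hYtr hs le_rfl
    rw [timeEvolution_self, sub_self, mul_zero, Real.exp_zero, mul_one] at h1
    have h2 := hY.traceNorm_antitone ((isBoundedHamiltonian_const hH₀).add hV) hs le_rfl
      (le_add_of_nonneg_right zero_le_one)
    nlinarith [traceNorm_nonneg (Y s)]

/-- Rounding the elapsed time down to whole periods costs less than one factor `q`; hence the
constant `q⁻¹` and the rate `-log q / T`. -/
theorem exists_exp_bound_of_iterate {T q : ℝ} (hT : 0 < T) (hq : 0 < q) (hq1 : q < 1) :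
    ∃ K γ : ℝ, 0 < K ∧ 0 < γ ∧ ∀ (s : ℝ) (f : ℝ → ℝ), (∀ t, 0 ≤ f t) →
      (∀ a b, s ≤ a → a ≤ b → f b ≤ f a) → (∀ a, s ≤ a → f (a + T) ≤ q * f a) →
        ∀ t, s ≤ t → f t ≤ K * Real.exp (-γ * (t - s)) * f s := by
  have hlog := Real.log_neg hq hq1
  refine ⟨q⁻¹, -Real.log q / T, by positivity, div_pos (neg_pos.2 hlog) hT,
    fun s f hf hanti hcon t ht => ?_⟩
  have hiter : ∀ n : ℕ, f (s + n * T) ≤ q ^ n * f s := by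
    intro n
    induction n with
    | zero => simp
    | succ n ih =>
      have h1 := hcon (s + n * T) (le_add_of_nonneg_right (by positivity))
      have h2 : s + ((n + 1 : ℕ) : ℝ) * T = s + n * T + T := by push_cast; ring
      rw [h2, pow_succ']
      calc _ ≤ _ := h1
        _ ≤ q * (q ^ n * f s) := mul_le_mul_of_nonneg_left ih hq.le
        _ = _ := by ring
  obtain ⟨x, hx⟩ : ∃ x, x = (t - s) / T := ⟨_, rfl⟩
  have hx0 : 0 ≤ x := by rw [hx]; exact div_nonneg (sub_nonneg.2 ht) hT.le
  have hxT : x * T = t - s := by rw [hx]; field_simp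
  have hfloor : (⌊x⌋₊ : ℝ) * T ≤ t - s := by
    rw [← hxT]; exact mul_le_mul_of_nonneg_right (Nat.floor_le hx0) hT.le
  have h1 := (hanti (s + ⌊x⌋₊ * T) t (le_add_of_nonneg_right (by positivity))
    (by linarith)).trans (hiter ⌊x⌋₊)
  refine h1.trans (mul_le_mul_of_nonneg_right ?_ (hf s))
  have h2 : -(-Real.log q / T) * (t - s) = Real.log q * x := by rw [hx]; field_simp
  rw [h2, ← Real.rpow_def_of_pos hq, ← Real.rpow_neg_one, ← Real.rpow_add hq, ← Real.rpow_natCast]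
  refine Real.rpow_le_rpow_of_exponent_ge hq hq1.le ?_
  linarith [Nat.lt_floor_add_one x]

theorem isExpContractive_of_isBoundedHamiltonian (hH₀ : H₀.IsHermitian)
    (hV : IsBoundedHamiltonian V v) (hK : 0 < K) (hγ : 0 < γ)
    (hcontr : ContractsWith (fun _ : ℝ => lindbladian H₀ L) K γ)
    (hv : v < γ / (2 + 2 * Real.log K)) :
    IsExpContractive (fun t : ℝ => lindbladian (H₀ + V t) L) := by
  have hH := (isBoundedHamiltonian_const hH₀).add hV
  obtain ⟨T, q, hT, hq, hq1, hcon⟩ := exists_uniform_contraction hH₀ hV hK hγ hcontr hv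
  obtain ⟨K', γ', hK', hγ', hbound⟩ := exists_exp_bound_of_iterate hT hq hq1
  refine ⟨K', γ', hK', hγ', fun ρ σ hρ hσ s t hs ht => ?_⟩
  obtain ⟨Y, hYdef⟩ : ∃ Y : ℝ → Matrix (Fin d) (Fin d) ℂ,
      Y = fun t => timeEvolution (fun t => lindbladian (H₀ + V t) L) t s (ρ - σ) := ⟨_, rfl⟩
  have hY : IsSolution (fun t => H₀ + V t) L 0 s Y :=
    hYdef ▸ hH.isSolution_timeEvolution L hs (ρ - σ)
  have hYs : Y s = ρ - σ := by rw [hYdef]; exact timeEvolution_self _ s (ρ - σ)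
  have hYh : (Y s).IsHermitian := hYs ▸ hρ.isHermitian_sub hσ
  have hYtr : (Y s).trace = 0 := hYs ▸ hρ.trace_sub hσ
  have hzero : ∀ a b : ℝ, s ≤ a → a ≤ b →
      IntervalIntegrable (0 : ℝ → Matrix (Fin d) (Fin d) ℂ) volume a b :=
    fun _ _ _ _ => intervalIntegrable_const (c := (0 : Matrix (Fin d) (Fin d) ℂ))
  have h := hbound s (fun t => traceNorm (Y t)) (fun t => traceNorm_nonneg _)
    (fun a b ha hab => hY.traceNorm_antitone hH hs ha hab)
    (fun a ha => hcon a Y (hs.trans ha) (hY.mono hH hs hzero ha) (hY.isHermitian hH hs hYh ha)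
      ((hY.trace_eq hH hs ha).trans hYtr)) t ht
  rw [abs_of_nonneg (sub_nonneg.2 ht)]
  simp only [hYs] at h
  simpa only [hYdef] using h

end Contraction

end DrivenLindblad

theorem mainTheorem1 {d m : ℕ}
    (L : Fin m → Matrix (Fin d) (Fin d) ℂ)
    (H₀ : Matrix (Fin d) (Fin d) ℂ) (hH₀ : H₀.IsHermitian)
    (V : ℝ → Matrix (Fin d) (Fin d) ℂ)
    (hV : ∀ t : ℝ, 0 ≤ t → (V t).IsHermitian)
    (hVint : MeasureTheory.LocallyIntegrableOn V (Set.Ici (0 : ℝ)) MeasureTheory.volume)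
    (K γ : ℝ) (hK : 0 < K) (hγ : 0 < γ)
    (hcontr : DrivenLindblad.ContractsWith
      (fun _ : ℝ => DrivenLindblad.lindbladian H₀ L) K γ)
    (hsmall : (⨆ (t : ℝ) (_ : 0 ≤ t), ‖V t‖ₑ) <
      ENNReal.ofReal (γ / (2 + 2 * Real.log K))) :
    DrivenLindblad.IsExpContractive
      (fun t : ℝ => DrivenLindblad.lindbladian (H₀ + V t) L) := by
  -- The strict bound makes the extended supremum finite; its real value serves as `v`.
  refine DrivenLindblad.isExpContractive_of_isBoundedHamiltonian hH₀
    ⟨hV, fun t ht => ?_, hVint.aestronglyMeasurable⟩ hK hγ hcontr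
    (ENNReal.toReal_lt_of_lt_ofReal hsmall)
  rw [← toReal_enorm]
  exact ENNReal.toReal_mono hsmall.ne_top (le_iSup₂ (f := fun (t : ℝ) (_ : 0 ≤ t) => ‖V t‖ₑ) t ht)
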